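/- Let $\mathbb{H}$ be the upper half plane, $q = e^{2\pi i z}$, let $M_w$ be the space of modular forms of weight $w$ for $\mathrm{SL}_2(\mathbb{Z})$, and let $E_2, E_4$ be the Eisenstein series of weights $2$ and $4$ with constant term $1$. For integers $\ell, w \ge 0$ let $$\widetilde{M}_{\ell,w} = \Big\{ \sum_{j=0}^{\ell} f_j E_2^{\,j} : f_j \in M_{w-2j} \Big\}$$ be the space of quasimodular forms of weight $w$ and depth at most $\ell$, and put $m = \dim_{\mathbb{C}} \widetilde{M}_{\ell,w}$. A form $f = \sum_{n\ge 0} a_n q^n \in \widetilde{M}_{\ell,w}$ has a *normalized extremal expansion* if $a_n = 0$ for all $n < m-1$ and $a_{m-1} = 1$. It is a *normalized extremal quasimodular form* of weight $w$ and depth $\ell$ if moreover its depth is exactly $\ell$, i.e. $f \notin \widetilde{M}_{\ell',w}$ for all $\ell' < \ell$. **Theorem.** Let $k \ge 0$ be an integer. Then $\dim_{\mathbb{C}} \widetilde{M}_{1,6k} = \dim_{\mathbb{C}} \widetilde{M}_{1,6k+4} = k+1$. Each of the spaces $\widetilde{M}_{1,6k}$ and $\widetilde{M}_{1,6k+4}$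 contains exactly one form with normalized extremal expansion; denote these forms by $\widetilde f_{1,6k}$ and $\widetilde f_{1,6k+4}$. If $k \ge 1$, both have depth exactly $1$, so they are the normalized extremal quasimodular forms of depth $1$ and weights $6k$ and $6k+4$. Moreover, for every $k \ge 0$, $$\widetilde f_{1,6k+4} = E_4 \, \widetilde f_{1,6k},$$ and every coefficient of the $q$-expansion of $\widetilde f_{1,6k+4}$ lies in $\mathbb{Z}\big[\tfrac1p : p \text{ prime},\ p < 6k\big]$, the subring of $\mathbb{C}$ generated by the inverses of the primes $p < 6k$. -/

import Mathlib

open scoped MatrixGroups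
open UpperHalfPlane

namespace Quasimodular

/-- The space of quasimodular forms of weight `w` and depth (at most) `ℓ` on `SL₂(ℤ)`: the functions
`f = ∑_{j ≤ ℓ} E₂ ^ j * g_j` with `g_j` a modular form of weight `w - 2 j` for `SL₂(ℤ)`. -/
noncomputable def quasimodularForms (ℓ w : ℕ) : Submodule ℂ (ℍ → ℂ) where
  carrier := {f | ∃ g : (j : ℕ) → ModularForm 𝒮ℒ ((w : ℤ) - 2 * (j : ℤ)),
    ∀ z, f z = ∑ j ∈ Finset.range (ℓ + 1), EisensteinSeries.E2 z ^ j * g j z}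
  zero_mem' := ⟨fun _ => 0, fun z => by simp⟩
  add_mem' := by
    rintro f₁ f₂ ⟨g₁, h₁⟩ ⟨g₂, h₂⟩
    refine ⟨fun j => g₁ j + g₂ j, fun z => ?_⟩
    simp [h₁, h₂, mul_add, Finset.sum_add_distrib]
  smul_mem' := by
    rintro c f ⟨g, h⟩
    refine ⟨fun j => c • g j, fun z => ?_⟩
    simp only [Pi.smul_apply, h, smul_eq_mul, Finset.mul_sum, smul_apply]
    exact Finset.sum_congr rfl fun j _ => by ring

/-- With `m` the dimension of the space of quasimodular forms of weight `w` and depth at most `ℓ`,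
the form `f` lies in this space and its `q`-expansion is `q ^ (m - 1) + O(q ^ m)`. -/
structure HasNormalizedExtremalExpansion (ℓ w : ℕ) (f : ℍ → ℂ) : Prop where
  mem : f ∈ quasimodularForms ℓ w
  coeff_eq_zero : ∀ n : ℕ, n + 1 < Module.finrank ℂ (quasimodularForms ℓ w) →
    (qExpansion 1 f).coeff n = 0
  coeff_eq_one : (qExpansion 1 f).coeff (Module.finrank ℂ (quasimodularForms ℓ w) - 1) = 1

/-- Normalized extremal quasimodular forms of weight `w` and (exact) depth `ℓ`. -/
structure IsNormalizedExtremal (ℓ w : ℕ) (f : ℍ → ℂ) : Prop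
    extends HasNormalizedExtremalExpansion ℓ w f where
  notMem_of_lt : ∀ ℓ' < ℓ, f ∉ quasimodularForms ℓ' w

/-- The subring `ℤ[1/p : p prime, p < N]` of `ℂ`. -/
noncomputable def primeInvRing (N : ℕ) : Subring ℂ :=
  Subring.closure {x : ℂ | ∃ p : ℕ, p.Prime ∧ p < N ∧ x = (p : ℂ)⁻¹}

end Quasimodular

/-! Write P, Q, R for the q-expansions of E₂, E₄, E₆. They have integer coefficients, and
`depthOneBasis` lists k + 1 monomials in them spanning weight 6k and depth at most 1; multiplying by
E₄ gives a spanning family in weight 6k + 4. Let d be the determinant of the integer matrix of their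
coefficients at q^0, ..., q^k. Once d ≠ 0, the monomials are independent and the extremal form is
unique, with coordinates the last row of the inverse matrix, hence in ℤ[1/d]. Since E₄ = 1 + O(q),
the same coordinates serve in weight 6k + 4. What remains is that d ≠ 0 and that no prime p ≥ 6k
divides d: the matrix must be invertible over ℂ and over 𝔽_p (`coeffMatrix_det_ne_zero`).

Over such a field only Ramanujan's equations for θ = q d/dq are needed. A kernel vector gives f = A
+ BP = O(q^(k+1)). The expression f² - 12(θf·B - f·θB) is modular of weight 12k and O(q^(k+1)), so
it vanishes by the valence bound, and this forces f = 0 in every characteristic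
(`eq_zero_of_wronskian_eq_zero`).

It remains to exclude nontrivial relations A + BP = 0. Modulo p they exist, because E_{p-1} ≡ 1 and
E_{p+1} ≡ E₂, but there B has weight p - 1, whereas here it has weight 6k - 2 < p - 1.
`eq_zero_of_add_mul_P_eq_zero` is a descent on the weight v of B which, besides 12, inverts only
integers v + 1 ≤ 6k - 1; this is the source of the bound 6k. -/

namespace Quasimodular

open PowerSeries

/-! ### Formal modular forms: power series satisfying Ramanujan's equations. -/

section FormalCore

/-- The derivation `q d/dq` on formal power series. -/
noncomputable def theta (K : Type*) [CommRing K] : Derivation K K⟦X⟧ K⟦X⟧ :=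
  (X : K⟦X⟧) • PowerSeries.derivative K

lemma coeff_theta {K : Type*} [CommRing K] (f : K⟦X⟧) (n : ℕ) :
    (theta K f).coeff n = n * f.coeff n := by
  rcases n with _ | n
  · simp [theta]
  · simp [theta, coeff_succ_X_mul, coeff_derivative, mul_comm]

lemma constantCoeff_theta {K : Type*} [CommRing K] (f : K⟦X⟧) : constantCoeff (theta K f) = 0 := by
  rw [← coeff_zero_eq_constantCoeff_apply, coeff_theta]
  simp

lemma theta_X_pow_mul {K : Type*} [CommRing K] (n : ℕ) (f : K⟦X⟧) :
    theta K (X ^ n * f) = X ^ n * ((n : K⟦X⟧) * f + theta K f) := by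
  have h : theta K (X ^ n : K⟦X⟧) = X ^ n * (n : K⟦X⟧) := by
    ext m
    rw [coeff_theta, mul_comm (X ^ n) (n : K⟦X⟧), ← map_natCast (PowerSeries.C (R := K)),
      coeff_C_mul, coeff_X_pow]
    split_ifs with h <;> simp [h]
  rw [Derivation.leibniz, h]
  simp only [smul_eq_mul]
  ring

/-- Power series with the initial coefficients and the differential equations of the
Eisenstein series `E₂`, `E₄`, `E₆`. -/
structure IsRamanujanTriple {K : Type*} [CommRing K] (P Q R : K⟦X⟧) : Prop where
  P_zero : constantCoeff P = 1
  Q_zero : constantCoeff Q = 1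
  R_zero : constantCoeff R = 1
  Q_one : Q.coeff 1 = 240
  R_one : R.coeff 1 = -504
  theta_P : 12 * theta K P = P ^ 2 - Q
  theta_Q : 3 * theta K Q = P * Q - R
  theta_R : 2 * theta K R = P * R - Q ^ 2

/-- The span of the monomials `Q ^ a * R ^ b` of weight `4 a + 6 b = w`. -/
def weightSpan {K : Type*} [CommRing K] (Q R : K⟦X⟧) (w : ℤ) : Submodule K K⟦X⟧ :=
  Submodule.span K {f | ∃ a b : ℕ, (4 * a + 6 * b : ℤ) = w ∧ f = Q ^ a * R ^ b}

section CommRing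

variable {K : Type*} [CommRing K] {P Q R : K⟦X⟧}

lemma monomial_mem_weightSpan {w : ℤ} (a b : ℕ) (h : (4 * a + 6 * b : ℤ) = w) :
    Q ^ a * R ^ b ∈ weightSpan Q R w :=
  Submodule.subset_span ⟨a, b, h, rfl⟩

lemma Q_mem_weightSpan : Q ∈ weightSpan Q R 4 := by
  simpa using monomial_mem_weightSpan (Q := Q) (R := R) 1 0 (by norm_num)

lemma R_mem_weightSpan : R ∈ weightSpan Q R 6 := by
  simpa using monomial_mem_weightSpan (Q := Q) (R := R) 0 1 (by norm_num)

lemma mul_mem_weightSpan {v w u : ℤ} {f g : K⟦X⟧} (hf : f ∈ weightSpan Q R v)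
    (hg : g ∈ weightSpan Q R w) (h : v + w = u) : f * g ∈ weightSpan Q R u := by
  have : weightSpan Q R v * weightSpan Q R w ≤ weightSpan Q R u := by
    rw [weightSpan, weightSpan, Submodule.span_mul_span, Submodule.span_le]
    rintro _ ⟨_, ⟨a, b, hab, rfl⟩, _, ⟨c, d, hcd, rfl⟩, rfl⟩
    refine Submodule.subset_span ⟨a + c, b + d, ?_, by ring⟩
    push_cast
    linarith
  exact this (Submodule.mul_mem_mul hf hg)

lemma C_mul_mem_weightSpan {w : ℤ} {f : K⟦X⟧} (c : K) (hf : f ∈ weightSpan Q R w) :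
    PowerSeries.C c * f ∈ weightSpan Q R w := by
  rw [← smul_eq_C_mul]
  exact Submodule.smul_mem _ c hf

lemma intCast_mul_mem_weightSpan {w : ℤ} {f : K⟦X⟧} (c : ℤ) (hf : f ∈ weightSpan Q R w) :
    (c : K⟦X⟧) * f ∈ weightSpan Q R w := by
  rw [← map_intCast (PowerSeries.C (R := K))]
  exact C_mul_mem_weightSpan _ hf

lemma eq_zero_of_mem_weightSpan_of_neg {w : ℤ} (hw : w < 0) {f : K⟦X⟧}
    (hf : f ∈ weightSpan Q R w) : f = 0 := by
  have : {f | ∃ a b : ℕ, (4 * a + 6 * b : ℤ) = w ∧ f = Q ^ a * R ^ b} = (∅ : Set K⟦X⟧) := by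
    ext f
    simp only [Set.mem_ofPred_eq, Set.mem_empty_iff_false, iff_false]
    rintro ⟨a, b, h, -⟩
    omega
  simpa [weightSpan, this] using hf

/-- The Serre derivative, multiplied by twelve, raises the weight by two. -/
lemma serre_mem_weightSpan (h : IsRamanujanTriple P Q R) {w : ℤ} {f : K⟦X⟧}
    (hf : f ∈ weightSpan Q R w) :
    12 * theta K f - (w : K⟦X⟧) * P * f ∈ weightSpan Q R (w + 2) := by
  induction hf using Submodule.span_induction with
  | zero => simp
  | add f g _ _ hf hg =>
    convert! add_mem hf hg using 1
    rw [map_add]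
    ring
  | smul c f _ hf =>
    convert! Submodule.smul_mem _ c hf using 1
    rw [(theta K).map_smul, smul_sub, mul_smul_comm, mul_smul_comm]
  | mem f hf =>
    obtain ⟨a, b, rfl, rfl⟩ := hf
    -- The Serre derivation sends Q to -4R and R to -6Q². The truncated exponents `a - 1`, `b - 1`
    -- are harmless: at zero the coefficient 4a or 6b vanishes.
    have key : 12 * theta K (Q ^ a * R ^ b) - ((4 * a + 6 * b : ℤ) : K⟦X⟧) * P * (Q ^ a * R ^ b) =
        -(((4 * a : ℤ) : K⟦X⟧) * (Q ^ (a - 1) * R ^ (b + 1))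
          + ((6 * b : ℤ) : K⟦X⟧) * (Q ^ (a + 2) * R ^ (b - 1))) := by
      rw [Derivation.leibniz, Derivation.leibniz_pow, Derivation.leibniz_pow]
      simp only [smul_eq_mul, nsmul_eq_mul]
      have hQ : (a : K⟦X⟧) * Q ^ a = a * (Q ^ (a - 1) * Q) := by
        rcases a with _ | a <;> simp [pow_succ]
      have hR : (b : K⟦X⟧) * R ^ b = b * (R ^ (b - 1) * R) := by
        rcases b with _ | b <;> simp [pow_succ]
      push_cast
      linear_combination (4 * a * Q ^ (a - 1) * R ^ b) * h.theta_Q +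
        (6 * b * Q ^ a * R ^ (b - 1)) * h.theta_R - 4 * P * R ^ b * hQ - 6 * P * Q ^ a * hR
    rw [key]
    refine neg_mem (add_mem ?_ ?_)
    · rcases a with _ | a
      · simp
      · exact intCast_mul_mem_weightSpan _
          (monomial_mem_weightSpan _ _ (by push_cast [Nat.add_sub_cancel]; ring))
    · rcases b with _ | b
      · simp
      · exact intCast_mul_mem_weightSpan _
          (monomial_mem_weightSpan _ _ (by push_cast [Nat.add_sub_cancel]; ring))

/-- The Wronskian attached to a quasimodular form of depth one is modular. -/
lemma wronskian_mem_weightSpan (h : IsRamanujanTriple P Q R) {w : ℤ} {A B : K⟦X⟧}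
    (hA : A ∈ weightSpan Q R w) (hB : B ∈ weightSpan Q R (w - 2)) :
    (A + B * P) ^ 2 - 12 * (theta K (A + B * P) * B - (A + B * P) * theta K B) ∈
      weightSpan Q R (2 * w) := by
  -- Rewritten through Serre derivatives, all terms containing P cancel against f²; only B²Q
  -- survives from θP.
  have key : (A + B * P) ^ 2 - 12 * (theta K (A + B * P) * B - (A + B * P) * theta K B) =
      A * A - (12 * theta K A - (w : K⟦X⟧) * P * A) * B +
        A * (12 * theta K B - ((w - 2 : ℤ) : K⟦X⟧) * P * B) + B * B * Q := by
    rw [map_add, Derivation.leibniz]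
    simp only [smul_eq_mul]
    push_cast
    linear_combination (-B ^ 2) * h.theta_P
  rw [key]
  refine add_mem (add_mem (sub_mem ?_ ?_) ?_) ?_
  · exact mul_mem_weightSpan hA hA (by ring)
  · exact mul_mem_weightSpan (serre_mem_weightSpan h hA) hB (by ring)
  · exact mul_mem_weightSpan hA (serre_mem_weightSpan h hB) (by ring)
  · exact mul_mem_weightSpan (mul_mem_weightSpan hB hB rfl) Q_mem_weightSpan (by ring)

end CommRing

/-! ### Valence bound, coprimality of Q and R, and relations with P over a field. -/

section Field

variable {K : Type*} [Field K] {P Q R : K⟦X⟧}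

/-- The discriminant `(Q ^ 3 - R ^ 2) / 1728`. -/
noncomputable def disc (Q R : K⟦X⟧) : K⟦X⟧ := PowerSeries.C (1728⁻¹ : K) * (Q ^ 3 - R ^ 2)

lemma disc_spec (h12 : (12 : K) ≠ 0) :
    Q ^ 3 - R ^ 2 = PowerSeries.C (1728 : K) * disc Q R := by
  have : (1728 : K) ≠ 0 := by
    have : (1728 : K) = 12 ^ 3 := by norm_num
    rw [this]
    exact pow_ne_zero _ h12
  rw [disc, ← mul_assoc, ← map_mul, mul_inv_cancel₀ this, map_one, one_mul]

lemma disc_mem_weightSpan : disc Q R ∈ weightSpan Q R 12 := by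
  refine C_mul_mem_weightSpan _ (sub_mem ?_ ?_)
  · simpa using monomial_mem_weightSpan (Q := Q) (R := R) 3 0 (by norm_num)
  · simpa using monomial_mem_weightSpan (Q := Q) (R := R) 0 2 (by norm_num)

lemma exists_disc_eq (h : IsRamanujanTriple P Q R) (h12 : (12 : K) ≠ 0) :
    ∃ u : K⟦X⟧, constantCoeff u = 1 ∧ disc Q R = X * u := by
  have h0 : constantCoeff (disc Q R) = 0 := by
    simp [disc, h.Q_zero, h.R_zero]
  obtain ⟨u, hu⟩ := X_dvd_iff.mpr h0
  refine ⟨u, ?_, hu⟩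
  have h1 : (disc Q R).coeff 1 = constantCoeff u := by
    rw [hu, ← coeff_zero_eq_constantCoeff_apply]
    exact coeff_succ_X_mul 0 u
  have hd := congrArg (coeff 1) (disc_spec (Q := Q) (R := R) h12)
  have hne : (1728 : K) ≠ 0 := by
    have : (1728 : K) = 12 ^ 3 := by norm_num
    rw [this]
    exact pow_ne_zero _ h12
  -- The linear coefficient of Q³ - R² is 3·240 + 2·504 = 1728.
  rw [coeff_C_mul, h1, map_sub, pow_succ, pow_two, pow_two, coeff_one_mul, coeff_one_mul,
    coeff_one_mul, map_mul, h.Q_zero, h.R_zero, h.Q_one, h.R_one] at hd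
  apply mul_left_cancel₀ hne
  rw [← hd]
  norm_num

lemma disc_ne_zero (h : IsRamanujanTriple P Q R) (h12 : (12 : K) ≠ 0) : disc Q R ≠ 0 := by
  obtain ⟨u, hu, hd⟩ := exists_disc_eq h h12
  rw [hd]
  refine mul_ne_zero X_ne_zero ?_
  rintro rfl
  simp at hu

lemma pow_sub_pow_mem (h12 : (12 : K) ≠ 0) (t : ℕ) :
    ∃ g ∈ weightSpan Q R (12 * t - 12), (Q ^ 3) ^ t - (R ^ 2) ^ t = disc Q R * g := by
  induction t with
  | zero => exact ⟨0, zero_mem _, by simp⟩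
  | succ t ih =>
    obtain ⟨g, hg, h⟩ := ih
    refine ⟨g * R ^ 2 + PowerSeries.C (1728 : K) * (Q ^ (3 * t)), add_mem ?_ ?_, ?_⟩
    · refine mul_mem_weightSpan (w := 12) hg ?_ (by push_cast; ring)
      simpa using monomial_mem_weightSpan (Q := Q) (R := R) 0 2 (by norm_num)
    · refine C_mul_mem_weightSpan _ ?_
      simpa using monomial_mem_weightSpan (Q := Q) (R := R) (w := 12 * ((t + 1 : ℕ) : ℤ) - 12)
        (3 * t) 0 (by push_cast; ring)
    · have hd := disc_spec (Q := Q) (R := R) h12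
      rw [pow_succ, pow_succ, pow_mul]
      linear_combination (R ^ 2) * h + (Q ^ 3) ^ t * hd

/-- Exponent pairs of equal weight differ by a multiple of (3, -2), so the difference contains a
factor Q^(3t) - R^(2t), which Q³ - R² = 1728Δ divides. -/
lemma monomial_sub_monomial_mem (h12 : (12 : K) ≠ 0) {a b c d : ℕ}
    (hw : 4 * a + 6 * b = 4 * c + 6 * d) :
    ∃ g ∈ weightSpan Q R (4 * a + 6 * b - 12), Q ^ a * R ^ b - Q ^ c * R ^ d = disc Q R * g := by
  wlog hac : c ≤ a generalizing a b c d
  · obtain ⟨g, hg, h⟩ := this hw.symm (by omega)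
    refine ⟨-g, neg_mem ?_, by rw [mul_neg, ← h]; ring⟩
    convert! hg using 2
    push_cast [← Nat.cast_inj (R := ℤ)] at hw
    linarith
  obtain ⟨t, rfl, rfl⟩ : ∃ t, a = c + 3 * t ∧ d = b + 2 * t := ⟨(a - c) / 3, by omega, by omega⟩
  obtain ⟨g, hg, h⟩ := pow_sub_pow_mem (Q := Q) (R := R) h12 t
  refine ⟨Q ^ c * R ^ b * g,
    mul_mem_weightSpan (monomial_mem_weightSpan c b rfl) hg (by push_cast; ring), ?_⟩
  rw [pow_add, pow_add, pow_mul, pow_mul]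
  linear_combination (Q ^ c * R ^ b) * h

/-- A form whose constant term vanishes is divisible by the discriminant. -/
lemma exists_eq_disc_mul (h : IsRamanujanTriple P Q R) (h12 : (12 : K) ≠ 0) {w : ℤ} {f : K⟦X⟧}
    (hf : f ∈ weightSpan Q R w) (h0 : constantCoeff f = 0) :
    ∃ g ∈ weightSpan Q R (w - 12), f = disc Q R * g := by
  by_cases hw : ∃ c d : ℕ, (4 * c + 6 * d : ℤ) = w
  · obtain ⟨c, d, hcd⟩ := hw
    have key : ∃ g ∈ weightSpan Q R (w - 12),
        f - PowerSeries.C (constantCoeff f) * (Q ^ c * R ^ d) = disc Q R * g := by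
      clear h0
      induction hf using Submodule.span_induction with
      | zero => exact ⟨0, zero_mem _, by simp⟩
      | add f g _ _ hf hg =>
        obtain ⟨u, hu, hfu⟩ := hf
        obtain ⟨v, hv, hgv⟩ := hg
        refine ⟨u + v, add_mem hu hv, ?_⟩
        rw [map_add, map_add]
        linear_combination hfu + hgv
      | smul c f _ hf =>
        obtain ⟨u, hu, hfu⟩ := hf
        refine ⟨PowerSeries.C c * u, C_mul_mem_weightSpan _ hu, ?_⟩
        rw [smul_eq_C_mul, map_mul, map_mul, constantCoeff_C]
        linear_combination PowerSeries.C c * hfu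
      | mem f hf =>
        obtain ⟨a, b, hab, rfl⟩ := hf
        obtain ⟨g, hg, hfg⟩ := monomial_sub_monomial_mem (Q := Q) (R := R) h12
          (a := a) (b := b) (c := c) (d := d) (by omega)
        exact ⟨g, hab ▸ hg, by simpa [h.Q_zero, h.R_zero] using hfg⟩
    simpa [h0] using key
  · have : {f | ∃ a b : ℕ, (4 * a + 6 * b : ℤ) = w ∧ f = Q ^ a * R ^ b} = (∅ : Set K⟦X⟧) := by
      ext f
      simp only [Set.mem_ofPred_eq, Set.mem_empty_iff_false, iff_false]
      rintro ⟨a, b, h, -⟩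
      exact hw ⟨a, b, h⟩
    exact ⟨0, zero_mem _, by simpa [weightSpan, this] using hf⟩

lemma X_pow_dvd_of_mul {u f : K⟦X⟧} (hu : constantCoeff u = 1) {n : ℕ} (h : X ^ n ∣ u * f) :
    X ^ n ∣ f := by
  have : IsUnit u := by simp [isUnit_iff_constantCoeff, hu]
  exact (this.dvd_mul_left).mp h

/-- A form of weight `w` vanishing at the cusp to an order exceeding `w / 12` is zero. -/
lemma eq_zero_of_X_pow_dvd (h : IsRamanujanTriple P Q R) (h12 : (12 : K) ≠ 0) (n : ℕ) {w : ℤ}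
    {f : K⟦X⟧} (hf : f ∈ weightSpan Q R w) (hn : w < 12 * n) (hd : X ^ n ∣ f) : f = 0 := by
  induction n generalizing w f with
  | zero => exact eq_zero_of_mem_weightSpan_of_neg (by simpa using hn) hf
  | succ n ih =>
    have h0 : constantCoeff f = 0 := X_dvd_iff.mp ((dvd_pow_self X n.succ_ne_zero).trans hd)
    obtain ⟨g, hg, rfl⟩ := exists_eq_disc_mul h h12 hf h0
    obtain ⟨u, hu, hdu⟩ := exists_disc_eq h h12
    rw [hdu, mul_assoc, pow_succ', mul_dvd_mul_iff_left X_ne_zero] at hd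
    rw [ih hg (by push_cast at hn; linarith) (X_pow_dvd_of_mul hu hd), mul_zero]

/-- A power of `R` is not a multiple of `Q`. -/
lemma R_pow_ne_Q_mul (h : IsRamanujanTriple P Q R) (h12 : (12 : K) ≠ 0) (n : ℕ) {Z : K⟦X⟧}
    (hZ : Z ∈ weightSpan Q R (6 * n - 4)) : R ^ n ≠ Q * Z := by
  intro hR
  -- Modulo Q one has R² ≡ -1728Δ, hence R^(2m) ≡ (-1728)^m Δ^m.
  have key : ∀ m : ℕ, ∃ S ∈ weightSpan Q R (12 * m - 4),
      (R ^ 2) ^ m = PowerSeries.C ((-1728) ^ m : K) * disc Q R ^ m + Q * S := by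
    intro m
    induction m with
    | zero => exact ⟨0, zero_mem _, by simp⟩
    | succ m ih =>
      obtain ⟨S, hS, hm⟩ := ih
      refine ⟨S * (PowerSeries.C (-1728 : K) * disc Q R) + Q ^ 2 * R ^ (2 * m), add_mem ?_ ?_, ?_⟩
      · exact mul_mem_weightSpan hS (C_mul_mem_weightSpan _ disc_mem_weightSpan)
          (by push_cast; ring)
      · exact monomial_mem_weightSpan _ _ (by push_cast; ring)
      · have hd := disc_spec (Q := Q) (R := R) h12
        simp only [map_pow, map_neg] at hm ⊢
        rw [pow_succ _ m, pow_succ _ m, pow_succ _ m, pow_mul]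
        linear_combination (-PowerSeries.C (1728 : K) * disc Q R) * hm - (R ^ 2) ^ m * hd
  obtain ⟨S, hS, hn⟩ := key n
  have hne : ((-1728) ^ n : K) ≠ 0 := by
    have : (-1728 : K) = -12 ^ 3 := by norm_num
    rw [this]
    exact pow_ne_zero _ (neg_ne_zero.mpr (pow_ne_zero _ h12))
  -- If R^n = QZ, then Δ^n is a multiple of Q up to a nonzero constant. The cofactor vanishes to
  -- order n but has weight 12n - 4 < 12n, so it is zero, contradicting Δ ≠ 0.
  have hT : Z * R ^ n - S ∈ weightSpan Q R (12 * n - 4) := by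
    refine sub_mem (mul_mem_weightSpan (w := 6 * n) hZ ?_ (by ring)) hS
    simpa using monomial_mem_weightSpan (Q := Q) (R := R) (w := 6 * n) 0 n (by simp)
  have hQT : PowerSeries.C ((-1728) ^ n : K) * disc Q R ^ n = Q * (Z * R ^ n - S) := by
    rw [← pow_mul, mul_comm 2 n, pow_mul] at hn
    linear_combination (R ^ n) * hR - hn
  have hX : X ^ n ∣ Z * R ^ n - S := by
    refine X_pow_dvd_of_mul h.Q_zero ?_
    rw [← hQT]
    obtain ⟨u, -, hdu⟩ := exists_disc_eq h h12
    rw [hdu, mul_pow]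
    exact ⟨PowerSeries.C ((-1728) ^ n : K) * u ^ n, by ring⟩
  rw [eq_zero_of_X_pow_dvd h h12 n hT (by linarith) hX, mul_zero, mul_eq_zero] at hQT
  rcases hQT with hc | hc
  · exact hne (by simpa using congrArg constantCoeff hc)
  · exact pow_ne_zero n (disc_ne_zero h h12) hc

/-- Modulo Q only a pure power of R can survive in Y. If it did, QZ = RY would make a power of R a
multiple of Q, which `R_pow_ne_Q_mul` forbids. -/
lemma exists_eq_Q_mul (h : IsRamanujanTriple P Q R) (h12 : (12 : K) ≠ 0) {v : ℤ} {Z Y : K⟦X⟧}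
    (hZ : Z ∈ weightSpan Q R (v + 2)) (hY : Y ∈ weightSpan Q R v) (hZY : Q * Z = R * Y) :
    ∃ Y' ∈ weightSpan Q R (v - 4), Y = Q * Y' := by
  have key : ∃ c : K, ∃ Y' ∈ weightSpan Q R (v - 4),
      Y = PowerSeries.C c * R ^ (v / 6).toNat + Q * Y' ∧ (c ≠ 0 → 6 * ((v / 6).toNat : ℤ) = v) := by
    clear hZY
    induction hY using Submodule.span_induction with
    | zero => exact ⟨0, 0, zero_mem _, by simp⟩
    | add f g _ _ hf hg =>
      obtain ⟨c, f', hf', hf, hc⟩ := hf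
      obtain ⟨d, g', hg', hg, hd⟩ := hg
      refine ⟨c + d, f' + g', add_mem hf' hg', ?_, fun hcd => ?_⟩
      · rw [map_add]
        linear_combination hf + hg
      · by_cases hc0 : c = 0
        · exact hd (by simpa [hc0] using hcd)
        · exact hc hc0
    | smul a f _ hf =>
      obtain ⟨c, f', hf', hf, hc⟩ := hf
      refine ⟨a * c, PowerSeries.C a * f', C_mul_mem_weightSpan _ hf', ?_,
        fun hac => hc (right_ne_zero_of_mul hac)⟩
      rw [smul_eq_C_mul, map_mul]
      linear_combination PowerSeries.C a * hf
    | mem f hf =>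
      obtain ⟨a, b, hab, rfl⟩ := hf
      rcases a with _ | a
      · refine ⟨1, 0, zero_mem _, ?_, fun _ => by omega⟩
        have : (v / 6).toNat = b := by omega
        simp [this]
      · refine ⟨0, Q ^ a * R ^ b, monomial_mem_weightSpan _ _ (by push_cast at hab; linarith), ?_,
          fun h => absurd rfl h⟩
        rw [map_zero]
        ring
  obtain ⟨c, Y', hY', rfl, hc⟩ := key
  by_cases hc0 : c = 0
  · exact ⟨Y', hY', by simp [hc0]⟩
  · exfalso
    have hv := hc hc0
    set m := (v / 6).toNat
    refine R_pow_ne_Q_mul h h12 (m + 1) (Z := PowerSeries.C c⁻¹ * (Z - R * Y')) ?_ ?_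
    · refine C_mul_mem_weightSpan _ (sub_mem ?_ ?_)
      · convert! hZ using 2
        push_cast
        linarith
      · refine mul_mem_weightSpan R_mem_weightSpan hY' ?_
        push_cast
        linarith
    · have hcc : PowerSeries.C c⁻¹ * PowerSeries.C c = (1 : K⟦X⟧) := by
        rw [← map_mul, inv_mul_cancel₀ hc0, map_one]
      rw [pow_succ]
      linear_combination (-R ^ m * R) * hcc - PowerSeries.C c⁻¹ * hZY

/-- In small weights there is no linear relation between `1` and `P` over the ring generated by
`Q` and `R`. -/
lemma eq_zero_of_add_mul_P_eq_zero (h : IsRamanujanTriple P Q R) (h12 : (12 : K) ≠ 0) (N : ℕ)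
    (hN : ∀ n : ℕ, 0 < n → n ≤ N → (n : K) ≠ 0) {v : ℤ} (hv : v < N) {A B : K⟦X⟧}
    (hA : A ∈ weightSpan Q R (v + 2)) (hB : B ∈ weightSpan Q R v) (hAB : A + B * P = 0) :
    B = 0 := by
  rcases lt_or_ge v 0 with hneg | hpos
  · exact eq_zero_of_mem_weightSpan_of_neg hneg hB
  lift v to ℕ using hpos
  induction v using Nat.strong_induction_on generalizing A B with
  | _ v ih =>
    have ih' : ∀ u : ℤ, u < v → ∀ A' B' : K⟦X⟧, A' ∈ weightSpan Q R (u + 2) →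
        B' ∈ weightSpan Q R u → A' + B' * P = 0 → B' = 0 := by
      intro u hu A' B' hA' hB' hAB'
      rcases lt_or_ge u 0 with hneg | hpos
      · exact eq_zero_of_mem_weightSpan_of_neg hneg hB'
      lift u to ℕ using hpos
      exact ih u (by exact_mod_cast hu) hAB' (hu.trans hv) hA' hB'
    have hΔ := disc_ne_zero h h12
    have h0 : constantCoeff A = - constantCoeff B := by
      have := congrArg constantCoeff hAB
      simp only [map_add, map_mul, h.P_zero, mul_one, map_zero] at this
      linear_combination this
    -- A relation whose two constant terms vanish can be divided by Δ, dropping the weight by 12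
    -- into the range of the induction.
    have hdiv : ∀ (u : ℤ) (A' B' : K⟦X⟧), u - 12 < v → A' ∈ weightSpan Q R (u + 2) →
        B' ∈ weightSpan Q R u → A' + B' * P = 0 → constantCoeff A' = 0 → constantCoeff B' = 0 →
        B' = 0 := by
      intro u A' B' hu hA' hB' hAB' hA0 hB0
      obtain ⟨A₂, hA₂, rfl⟩ := exists_eq_disc_mul h h12 hA' hA0
      obtain ⟨B₂, hB₂, rfl⟩ := exists_eq_disc_mul h h12 hB' hB0
      rw [ih' (u - 12) hu A₂ B₂ (by convert! hA₂ using 2; ring) hB₂ ?_, mul_zero]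
      refine (mul_eq_zero.mp (?_ : disc Q R * (A₂ + B₂ * P) = 0)).resolve_left hΔ
      linear_combination hAB'
    by_cases hb : constantCoeff B = 0
    · exact hdiv v A B (by linarith) hA hB hAB (by rw [h0, hb, neg_zero]) hb
    -- Twelve times the θ-derivative of A + BP = 0, minus (v + 1)P times the relation itself: a new
    -- relation with B₁ of weight v + 2.
    set A₁ := 12 * theta K A - ((v + 2 : ℤ) : K⟦X⟧) * P * A - B * Q with hA₁
    set B₁ := 12 * theta K B - ((v : ℤ) : K⟦X⟧) * P * B + A with hB₁
    have hA₁m : A₁ ∈ weightSpan Q R (v + 4) := by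
      refine sub_mem ?_ (mul_mem_weightSpan hB Q_mem_weightSpan rfl)
      convert! serre_mem_weightSpan h hA using 2
    have hB₁m : B₁ ∈ weightSpan Q R (v + 2) := add_mem (serre_mem_weightSpan h hB) hA
    have hrel : A₁ + B₁ * P = 0 := by
      have hD := congrArg (theta K) hAB
      rw [map_add, Derivation.leibniz, map_zero] at hD
      simp only [smul_eq_mul] at hD
      rw [hA₁, hB₁]
      push_cast
      linear_combination 12 * hD - B * h.theta_P - (v + 1) * P * hAB
    have hA₁0 : constantCoeff A₁ = (v + 1) * constantCoeff B := by
      rw [hA₁]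
      simp only [map_sub, map_mul, constantCoeff_theta, h.P_zero, h.Q_zero, h0, map_intCast]
      push_cast
      ring
    have hB₁0 : constantCoeff B₁ = -(v + 1) * constantCoeff B := by
      rw [hB₁]
      simp only [map_sub, map_add, map_mul, constantCoeff_theta, h.P_zero, h0, map_intCast]
      push_cast
      ring
    -- This combination of the two relations is chosen to have zero constant terms. It has weight v
    -- + 6, so division by Δ lands in weight v - 6 and the induction makes it trivial.
    have hBz : Q * B₁ + ((v + 1 : ℤ) : K⟦X⟧) * (R * B) = 0 := by
      refine hdiv (v + 6) (Q * A₁ + ((v + 1 : ℤ) : K⟦X⟧) * (R * A)) _ (by linarith)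
        (add_mem ?_ (intCast_mul_mem_weightSpan _ ?_))
        (add_mem ?_ (intCast_mul_mem_weightSpan _ ?_)) ?_ ?_ ?_
      · exact mul_mem_weightSpan Q_mem_weightSpan hA₁m (by ring)
      · exact mul_mem_weightSpan R_mem_weightSpan hA (by ring)
      · exact mul_mem_weightSpan Q_mem_weightSpan hB₁m (by ring)
      · exact mul_mem_weightSpan R_mem_weightSpan hB (by ring)
      · linear_combination Q * hrel + ((v + 1 : ℤ) : K⟦X⟧) * R * hAB
      · simp only [map_add, map_mul, h.Q_zero, h.R_zero, hA₁0, h0, map_intCast]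
        push_cast
        ring
      · simp only [map_add, map_mul, h.Q_zero, h.R_zero, hB₁0, map_intCast]
        push_cast
        ring
    have hAz : Q * A₁ + ((v + 1 : ℤ) : K⟦X⟧) * (R * A) = 0 := by
      linear_combination Q * hrel + ((v + 1 : ℤ) : K⟦X⟧) * R * hAB - P * hBz
    -- The only use of `hN`. With v + 1 inverted, coprimality of Q and R lets Q be cancelled from
    -- both A and B, reaching weight v - 4.
    have hv1 : ((v + 1 : ℕ) : K) ≠ 0 := hN _ v.succ_pos (by omega)
    have hunit : PowerSeries.C ((v + 1 : ℕ) : K)⁻¹ * ((v + 1 : ℤ) : K⟦X⟧) = 1 := by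
      have : ((v + 1 : ℤ) : K⟦X⟧) = PowerSeries.C ((v + 1 : ℕ) : K) := by
        rw [map_natCast]
        push_cast
        ring
      rw [this, ← map_mul, inv_mul_cancel₀ hv1, map_one]
    obtain ⟨A', hA', rfl⟩ := exists_eq_Q_mul h h12 (v := v + 2)
      (Z := PowerSeries.C (-((v + 1 : ℕ) : K)⁻¹) * A₁)
      (C_mul_mem_weightSpan _ (by convert! hA₁m using 2)) hA (by
        rw [map_neg]
        linear_combination (-PowerSeries.C ((v + 1 : ℕ) : K)⁻¹) * hAz + R * A * hunit)
    obtain ⟨B', hB', rfl⟩ := exists_eq_Q_mul h h12 (v := v)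
      (Z := PowerSeries.C (-((v + 1 : ℕ) : K)⁻¹) * B₁)
      (C_mul_mem_weightSpan _ hB₁m) hB (by
        rw [map_neg]
        linear_combination (-PowerSeries.C ((v + 1 : ℕ) : K)⁻¹) * hBz + R * B * hunit)
    have hQ : Q ≠ 0 := by
      intro hQ
      simpa [hQ] using h.Q_zero
    rw [ih' (v - 4) (by linarith) A' B' (by convert! hA' using 2; ring) hB' ?_, mul_zero]
    refine (mul_eq_zero.mp (?_ : Q * (A' + B' * P) = 0)).resolve_left hQ
    linear_combination hAB

/-- For f ≠ 0 the hypothesis says 1 = -12 θ(B/f) as Laurent series, but θ kills constant terms. No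
division by integers occurs, so the characteristic is irrelevant. -/
lemma eq_zero_of_wronskian_eq_zero {f B : K⟦X⟧}
    (hW : f ^ 2 - 12 * (theta K f * B - f * theta K B) = 0) : f = 0 := by
  by_contra hf
  obtain ⟨r, F, hF0, hF⟩ : ∃ (r : ℕ) (F : K⟦X⟧), constantCoeff F ≠ 0 ∧ f = X ^ r * F :=
    ⟨_, f.divXPowOrder, mt constantCoeff_divXPowOrder_eq_zero_iff.mp hf,
      X_pow_order_mul_divXPowOrder.symm⟩
  obtain ⟨V, rfl⟩ : ∃ V, B = V * F :=
    ⟨B * F⁻¹, by rw [mul_assoc, PowerSeries.inv_mul_cancel F hF0, mul_one]⟩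
  have hFne : F ≠ 0 := by
    rintro rfl
    simp at hF0
  have key : X ^ r * F ^ 2 * (X ^ r - 12 * ((r : K⟦X⟧) * V - theta K V)) = 0 := by
    rw [hF, theta_X_pow_mul, Derivation.leibniz] at hW
    simp only [smul_eq_mul] at hW
    linear_combination hW
  have hz := (mul_eq_zero.mp key).resolve_left
    (mul_ne_zero (pow_ne_zero _ X_ne_zero) (pow_ne_zero _ hFne))
  -- At X^r the term rV - θV contributes r·v - r·v = 0, leaving 1 = 0.
  have hc := congrArg (coeff r) hz
  have e12 : (12 : K⟦X⟧) = PowerSeries.C (12 : K) := (map_ofNat _ 12).symm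
  rw [e12, ← map_natCast (PowerSeries.C (R := K)), map_sub, coeff_C_mul, map_sub, coeff_C_mul,
    coeff_theta, coeff_X_pow_self] at hc
  simp at hc

/-- A depth one form of weight `6 k` whose `q`-expansion vanishes up to `q ^ k` is zero. -/
lemma eq_zero_of_extremal (h : IsRamanujanTriple P Q R) (h12 : (12 : K) ≠ 0) (k : ℕ)
    {A B : K⟦X⟧} (hA : A ∈ weightSpan Q R (6 * k)) (hB : B ∈ weightSpan Q R (6 * k - 2))
    (hd : X ^ (k + 1) ∣ A + B * P) : A + B * P = 0 := by
  refine eq_zero_of_wronskian_eq_zero (B := B) ?_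
  refine eq_zero_of_X_pow_dvd h h12 (k + 1) (wronskian_mem_weightSpan h hA hB)
    (by push_cast; linarith) ?_
  obtain ⟨g, hg⟩ := hd
  rw [hg, theta_X_pow_mul]
  exact ⟨X ^ (k + 1) * g ^ 2 - 12 * ((((k + 1 : ℕ) : K⟦X⟧) * g + theta K g) * B - g * theta K B),
    by ring⟩

end Field

end FormalCore

/-! ### The coefficient matrix, its determinant modulo primes, and the extremal coordinates. -/

section ExtremalBasis

lemma map_theta {K L : Type*} [CommRing K] [CommRing L] (φ : K →+* L) (f : K⟦X⟧) :
    PowerSeries.map φ (theta K f) = theta L (PowerSeries.map φ f) := by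
  ext n
  simp [coeff_theta]

lemma IsRamanujanTriple.map {K L : Type*} [CommRing K] [CommRing L] (φ : K →+* L)
    {P Q R : K⟦X⟧} (h : IsRamanujanTriple P Q R) :
    IsRamanujanTriple (PowerSeries.map φ P) (PowerSeries.map φ Q) (PowerSeries.map φ R) where
  P_zero := by
    rw [← coeff_zero_eq_constantCoeff_apply, coeff_map, coeff_zero_eq_constantCoeff_apply,
      h.P_zero, map_one]
  Q_zero := by
    rw [← coeff_zero_eq_constantCoeff_apply, coeff_map, coeff_zero_eq_constantCoeff_apply,
      h.Q_zero, map_one]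
  R_zero := by
    rw [← coeff_zero_eq_constantCoeff_apply, coeff_map, coeff_zero_eq_constantCoeff_apply,
      h.R_zero, map_one]
  Q_one := by rw [coeff_map, h.Q_one]; exact map_ofNat φ 240
  R_one := by rw [coeff_map, h.R_one, map_neg]; exact congrArg _ (map_ofNat φ 504)
  theta_P := by
    have := congrArg (PowerSeries.map φ) h.theta_P
    rw [map_mul, map_theta] at this
    simpa [map_ofNat (PowerSeries.map φ) 12] using this
  theta_Q := by
    have := congrArg (PowerSeries.map φ) h.theta_Q
    rw [map_mul, map_theta] at this
    simpa [map_ofNat (PowerSeries.map φ) 3] using this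
  theta_R := by
    have := congrArg (PowerSeries.map φ) h.theta_R
    rw [map_mul, map_theta] at this
    simpa [map_ofNat (PowerSeries.map φ) 2] using this

/-- The elements `(P Q) ^ (n % 2) Q ^ (3 ⌊n / 2⌋) R ^ (k - n)`, `n ≤ k`, of a basis of the forms of
depth one and weight `6 k`. -/
def depthOneBasis {A : Type*} [Monoid A] (P Q R : A) (k n : ℕ) : A :=
  (P * Q) ^ (n % 2) * Q ^ (3 * (n / 2)) * R ^ (k - n)

/-- The first `q`-expansion coefficients of the elements of `depthOneBasis`. -/
noncomputable def coeffMatrix {K : Type*} [CommRing K] (P Q R : K⟦X⟧) (k : ℕ) :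
    Matrix (Fin (k + 1)) (Fin (k + 1)) K :=
  Matrix.of fun n j => (depthOneBasis P Q R k n).coeff j

lemma coeffMatrix_map {K L : Type*} [CommRing K] [CommRing L] (φ : K →+* L) (P Q R : K⟦X⟧)
    (k : ℕ) : coeffMatrix (PowerSeries.map φ P) (PowerSeries.map φ Q) (PowerSeries.map φ R) k =
      φ.mapMatrix (coeffMatrix P Q R k) := by
  ext n j
  simp [coeffMatrix, depthOneBasis, ← map_mul, ← map_pow]

lemma vecMul_coeffMatrix {K : Type*} [CommRing K] (P Q R : K⟦X⟧) (k : ℕ) (x : Fin (k + 1) → K)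
    (j : Fin (k + 1)) : Matrix.vecMul x (coeffMatrix P Q R k) j =
      (∑ n, x n • depthOneBasis P Q R k n).coeff j := by
  simp [Matrix.vecMul, dotProduct, coeffMatrix]

section Field

variable {K : Type*} [Field K] {P Q R : K⟦X⟧}

/-- Among indices of one parity the smallest carries the least power of Q. After cancelling that
power, a nonzero coefficient there would make a power of R a multiple of Q. -/
lemma eq_zero_of_sum_monomials_eq_zero (h : IsRamanujanTriple P Q R) (h12 : (12 : K) ≠ 0)
    {k ε : ℕ} (c : ℕ → K) (s : Finset ℕ) (hs : ∀ n ∈ s, n % 2 = ε ∧ n ≤ k)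
    (h0 : ∑ n ∈ s, PowerSeries.C (c n) * (Q ^ (3 * (n / 2)) * R ^ (k - n)) = 0) :
    ∀ n ∈ s, c n = 0 := by
  have hQ : Q ≠ 0 := by
    rintro hQ
    simpa [hQ] using h.Q_zero
  induction s using Finset.induction_on_min with
  | empty => simp
  | insert a s has ih =>
    have ha := hs a (Finset.mem_insert_self a s)
    have hnot : a ∉ s := fun h => lt_irrefl _ (has a h)
    have hca : c a = 0 := by
      by_contra hca
      set T := ∑ n ∈ s, PowerSeries.C (c n) *
        (Q ^ (3 * (n / 2) - 3 * (a / 2) - 1) * R ^ (k - n)) with hT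
      have hTm : T ∈ weightSpan Q R (6 * (k - a : ℕ) - 4) := by
        refine Submodule.sum_mem _ fun n hn => C_mul_mem_weightSpan _ ?_
        have := hs n (Finset.mem_insert_of_mem hn)
        have := has n hn
        exact monomial_mem_weightSpan _ _ (by omega)
      have hfac : Q ^ (3 * (a / 2)) * (PowerSeries.C (c a) * R ^ (k - a) + Q * T) = 0 := by
        rw [← h0, Finset.sum_insert hnot, hT, mul_add, Finset.mul_sum, Finset.mul_sum]
        congr 1
        · ring
        · refine Finset.sum_congr rfl fun n hn => ?_
          have h1 := hs n (Finset.mem_insert_of_mem hn)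
          have h2 := has n hn
          have h3 : 3 * (n / 2) = 3 * (a / 2) + 1 + (3 * (n / 2) - 3 * (a / 2) - 1) := by omega
          conv_rhs => rw [h3]
          ring
      have hz := (mul_eq_zero.mp hfac).resolve_left (pow_ne_zero _ hQ)
      refine R_pow_ne_Q_mul h h12 (k - a) (C_mul_mem_weightSpan (-(c a)⁻¹) hTm) ?_
      have hcc : PowerSeries.C (c a)⁻¹ * PowerSeries.C (c a) = (1 : K⟦X⟧) := by
        rw [← map_mul, inv_mul_cancel₀ hca, map_one]
      rw [map_neg]
      linear_combination (-R ^ (k - a)) * hcc + PowerSeries.C (c a)⁻¹ * hz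
    intro n hn
    rcases Finset.mem_insert.mp hn with rfl | hn
    · exact hca
    · refine ih (fun n hn => hs n (Finset.mem_insert_of_mem hn)) ?_ n hn
      simpa [Finset.sum_insert hnot, hca] using h0

/-- If all `0 < n < 6 k` are invertible in the field `K`, then a depth one form of weight `6 k` over
`K` is determined by its first `k + 1` coefficients. -/
lemma coeffMatrix_det_ne_zero (h : IsRamanujanTriple P Q R) (h12 : (12 : K) ≠ 0) (k : ℕ)
    (hN : ∀ n : ℕ, 0 < n → n < 6 * k → (n : K) ≠ 0) : (coeffMatrix P Q R k).det ≠ 0 := by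
  intro hdet
  obtain ⟨x, hx, hxM⟩ := Matrix.exists_vecMul_eq_zero_iff.mpr hdet
  set c : ℕ → K := fun n => if hn : n < k + 1 then x ⟨n, hn⟩ else 0 with hc
  have hcx : ∀ n : Fin (k + 1), c n = x n := fun n => dif_pos n.isLt
  set F : ℕ → K⟦X⟧ := fun n => PowerSeries.C (c n) * (Q ^ (3 * (n / 2)) * R ^ (k - n)) with hF
  set sE := (Finset.range (k + 1)).filter (fun n => n % 2 = 0) with hsE
  set sO := (Finset.range (k + 1)).filter (fun n => ¬ n % 2 = 0) with hsO
  have hmE : ∀ n ∈ sE, n % 2 = 0 ∧ n ≤ k := by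
    intro n hn
    simp only [hsE, Finset.mem_filter, Finset.mem_range] at hn
    omega
  have hmO : ∀ n ∈ sO, n % 2 = 1 ∧ n ≤ k := by
    intro n hn
    simp only [hsO, Finset.mem_filter, Finset.mem_range] at hn
    omega
  set A := ∑ n ∈ sE, F n with hA
  set B := Q * ∑ n ∈ sO, F n with hB
  have hsum : ∑ n, x n • depthOneBasis P Q R k n = A + B * P := by
    have h1 : ∑ n, x n • depthOneBasis P Q R k n =
        ∑ n ∈ Finset.range (k + 1), c n • depthOneBasis P Q R k n := by
      rw [Finset.sum_range]
      simp [hcx]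
    rw [h1, ← Finset.sum_filter_add_sum_filter_not _ (fun n => n % 2 = 0), hA, hB,
      Finset.mul_sum, Finset.sum_mul]
    congr 1
    · refine Finset.sum_congr rfl fun n hn => ?_
      simp [depthOneBasis, hF, (hmE n hn).1, smul_eq_C_mul]
    · refine Finset.sum_congr rfl fun n hn => ?_
      simp only [depthOneBasis, hF, (hmO n hn).1, smul_eq_C_mul]
      ring
  have hAm : A ∈ weightSpan Q R (6 * k) := by
    refine Submodule.sum_mem _ fun n hn => C_mul_mem_weightSpan _ ?_
    have := hmE n hn
    exact monomial_mem_weightSpan _ _ (by omega)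
  have hBm : B ∈ weightSpan Q R (6 * k - 2) := by
    refine mul_mem_weightSpan (w := 6 * k - 6) Q_mem_weightSpan
      (Submodule.sum_mem _ fun n hn => C_mul_mem_weightSpan _ ?_) (by ring)
    have := hmO n hn
    exact monomial_mem_weightSpan _ _ (by omega)
  have hAB : A + B * P = 0 := by
    refine eq_zero_of_extremal h h12 k hAm hBm (X_pow_dvd_iff.mpr fun m hm => ?_)
    rw [← hsum]
    have := congrFun hxM ⟨m, hm⟩
    rwa [vecMul_coeffMatrix] at this
  have hB0 : B = 0 := by
    -- B has weight v = 6k - 2, so v + 1 = 6k - 1 is the largest integer that must be invertible.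
    refine eq_zero_of_add_mul_P_eq_zero h h12 (6 * k - 1) (fun n h1 h2 => hN n h1 (by omega))
      (v := 6 * k - 2) (by omega) (by convert! hAm using 2; ring) hBm hAB
  have hA0 : A = 0 := by simpa [hB0] using hAB
  have hQ : Q ≠ 0 := by
    rintro hQ
    simpa [hQ] using h.Q_zero
  have hE := eq_zero_of_sum_monomials_eq_zero h h12 c sE hmE hA0
  have hO := eq_zero_of_sum_monomials_eq_zero h h12 c sO hmO ((mul_eq_zero.mp hB0).resolve_left hQ)
  refine hx (funext fun n => ?_)
  rw [← hcx, Pi.zero_apply]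
  by_cases hn : (n : ℕ) % 2 = 0
  · exact hE n (by simp only [hsE, Finset.mem_filter, Finset.mem_range]; omega)
  · exact hO n (by simp only [hsO, Finset.mem_filter, Finset.mem_range]; omega)

end Field

lemma inv_natCast_mem_primeInvRing {N : ℕ} (n : ℕ) (hn : n ≠ 0)
    (hp : ∀ p : ℕ, p.Prime → p ∣ n → p < N) : (n : ℂ)⁻¹ ∈ primeInvRing N := by
  induction n using induction_on_primes with
  | zero => exact absurd rfl hn
  | one => simp
  | prime_mul p a hpp ih =>
    rw [Nat.cast_mul, mul_inv]
    refine mul_mem (Subring.subset_closure ⟨p, hpp, hp p hpp (dvd_mul_right p a), rfl⟩)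
      (ih (right_ne_zero_of_mul hn) fun q hq hqa => hp q hq (hqa.mul_left p))

variable {P Q R : ℤ⟦X⟧}

lemma coeffMatrix_complex_det_ne_zero (h : IsRamanujanTriple P Q R) (k : ℕ) :
    (coeffMatrix (P.map (Int.castRingHom ℂ)) (Q.map (Int.castRingHom ℂ))
      (R.map (Int.castRingHom ℂ)) k).det ≠ 0 :=
  coeffMatrix_det_ne_zero (h.map _) (by norm_num) k fun n hn _ => by exact_mod_cast hn.ne'

/-- A prime p ≥ 6k dividing the determinant would make the matrix singular over `ZMod p`, where all
0 < n < 6k are still invertible. -/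
lemma inv_det_mem_primeInvRing (h : IsRamanujanTriple P Q R) (k : ℕ) :
    ((coeffMatrix P Q R k).det : ℂ)⁻¹ ∈ primeInvRing (6 * k) := by
  set d := (coeffMatrix P Q R k).det with hd
  have hd0 : d ≠ 0 := by
    have := coeffMatrix_complex_det_ne_zero h k
    rw [coeffMatrix_map, ← RingHom.map_det] at this
    intro h0
    exact this (by rw [← hd, h0, map_zero])
  have key : (d.natAbs : ℂ)⁻¹ ∈ primeInvRing (6 * k) := by
    refine inv_natCast_mem_primeInvRing _ (Int.natAbs_ne_zero.mpr hd0) fun p hp hpd => ?_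
    by_contra! hpk
    rcases Nat.eq_zero_or_pos k with rfl | hk
    · have h1 : d = 1 := by
        rw [hd, Matrix.det_fin_one]
        simp [coeffMatrix, depthOneBasis]
      rw [h1] at hpd
      exact hp.one_lt.ne' (Nat.dvd_one.mp hpd)
    · have : Fact p.Prime := ⟨hp⟩
      have hlt : ∀ n : ℕ, 0 < n → n < p → ((n : ℕ) : ZMod p) ≠ 0 := fun n h1 h2 h3 =>
        absurd (Nat.le_of_dvd h1 ((ZMod.natCast_eq_zero_iff n p).mp h3)) (by omega)
      have h12 : (12 : ZMod p) ≠ 0 := by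
        have h3 := hlt 3 (by norm_num) (by omega)
        have h4 := hlt 4 (by norm_num) (by omega)
        have := mul_ne_zero h3 h4
        norm_num at this ⊢
        exact this
      refine coeffMatrix_det_ne_zero (h.map (Int.castRingHom (ZMod p))) h12 k
        (fun n h1 h2 => hlt n h1 (by omega)) ?_
      rw [coeffMatrix_map, ← RingHom.map_det, ← hd, eq_intCast, ZMod.intCast_zmod_eq_zero_iff_dvd]
      exact Int.natCast_dvd.mpr hpd
  rcases Int.natAbs_eq d with h1 | h1
  · rw [h1]
    simpa using key
  · rw [h1]
    simpa using key

/-- The vector is the last row of the inverse matrix; the adjugate is integral, so only the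
determinant enters the denominators. -/
lemma exists_extremal_vector (h : IsRamanujanTriple P Q R) (k : ℕ) :
    ∃ x : Fin (k + 1) → ℂ, (∀ n, x n ∈ primeInvRing (6 * k)) ∧
      Matrix.vecMul x (coeffMatrix (P.map (Int.castRingHom ℂ)) (Q.map (Int.castRingHom ℂ))
        (R.map (Int.castRingHom ℂ)) k) = Pi.single (Fin.last k) 1 := by
  have hdet := coeffMatrix_complex_det_ne_zero h k
  set M := coeffMatrix (P.map (Int.castRingHom ℂ)) (Q.map (Int.castRingHom ℂ))
        (R.map (Int.castRingHom ℂ)) k with hM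
  refine ⟨Matrix.vecMul (Pi.single (Fin.last k) 1) M⁻¹, fun n => ?_, ?_⟩
  · rw [Matrix.single_one_vecMul, Matrix.inv_def, Ring.inverse_eq_inv', hM, coeffMatrix_map,
      ← RingHom.map_det, ← RingHom.map_adjugate]
    exact mul_mem (inv_det_mem_primeInvRing h k) (intCast_mem _ _)
  · rw [Matrix.vecMul_vecMul, Matrix.nonsing_inv_mul _ (isUnit_iff_ne_zero.mpr hdet),
      Matrix.vecMul_one]

end ExtremalBasis

/-! ### q-expansions, the derivative q d/dq, and modularity of Serre derivatives. -/

section Analytic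

open Function Derivative EisensteinSeries ModularForm
open scoped Manifold Real Topology

/-- The algebra of holomorphic functions of period one on the upper half plane that are bounded at
the cusp. -/
def cuspHolomorphic : Subalgebra ℂ (ℍ → ℂ) where
  carrier := {f | Periodic (f ∘ ofComplex) ((1 : ℝ) : ℂ) ∧ MDiff f ∧ IsBoundedAtImInfty f}
  mul_mem' hf hg := ⟨hf.1.mul hg.1, hf.2.1.mul hg.2.1,
    (boundedAtImInftySubalgebra ℂ).mul_mem hf.2.2 hg.2.2⟩
  add_mem' hf hg := ⟨hf.1.add hg.1, hf.2.1.add hg.2.1,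
    (boundedAtImInftySubalgebra ℂ).add_mem hf.2.2 hg.2.2⟩
  algebraMap_mem' c := ⟨fun _ => rfl, mdifferentiable_const,
    Subalgebra.algebraMap_mem (boundedAtImInftySubalgebra ℂ) c⟩

lemma analyticAt_cuspFunction {f : ℍ → ℂ} (hf : f ∈ cuspHolomorphic) :
    AnalyticAt ℂ (cuspFunction 1 f) 0 :=
  analyticAt_cuspFunction_zero one_pos hf.1 hf.2.1 hf.2.2

/-- The `q`-expansion as a homomorphism of algebras. -/
noncomputable def qExpansionHom : cuspHolomorphic →ₐ[ℂ] ℂ⟦X⟧ :=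
  AlgHom.ofLinearMap
    { toFun := fun f => qExpansion 1 (f : ℍ → ℂ)
      map_add' := fun f g =>
        qExpansion_add (analyticAt_cuspFunction f.2) (analyticAt_cuspFunction g.2)
      map_smul' := fun c f => qExpansion_smul (analyticAt_cuspFunction f.2) c }
    (qExpansion_one 1)
    (fun f g => qExpansion_mul (analyticAt_cuspFunction f.2) (analyticAt_cuspFunction g.2))

lemma qExpansionHom_apply (f : cuspHolomorphic) : qExpansionHom f = qExpansion 1 (f : ℍ → ℂ) := rfl

lemma coe_mem_cuspHolomorphic {w : ℤ} (f : ModularForm 𝒮ℒ w) : (f : ℍ → ℂ) ∈ cuspHolomorphic :=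
  ⟨SlashInvariantFormClass.periodic_comp_ofComplex f one_mem_strictPeriods_SL,
    ModularFormClass.holo f, ModularFormClass.bdd_at_infty f⟩

/-- Gives access to functions that are not modular, namely E₂ and derivatives, through a convergent
q-series. -/
lemma mem_cuspHolomorphic_of_hasSum {f : ℍ → ℂ} (hf : MDiff f) {φ : ℂ⟦X⟧}
    (h : ∀ z : ℍ, HasSum (fun n => φ.coeff n • Periodic.qParam 1 z ^ n) (f z)) :
    f ∈ cuspHolomorphic ∧ qExpansion 1 f = φ := by
  have hmem : f ∈ cuspHolomorphic := by
    refine ⟨fun w => ?_, hf, isBoundedAtImInfty_of_hasSum_qExpansion one_pos h⟩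
    by_cases! hw : 0 < w.im
    · have hw' : 0 < (w + ((1 : ℝ) : ℂ)).im := by simpa using hw
      have h1 := h ⟨w, hw⟩
      have h2 := h ⟨w + ((1 : ℝ) : ℂ), hw'⟩
      have hq : Periodic.qParam 1 (w + ((1 : ℝ) : ℂ)) = Periodic.qParam 1 w :=
        by
        simp [Periodic.qParam, mul_add, Complex.exp_add]
      simp only [comp_apply, ofComplex_apply_of_im_pos hw, ofComplex_apply_of_im_pos hw']
      simp only [hq] at h2
      exact h2.unique h1
    · have hw' : (w + ((1 : ℝ) : ℂ)).im ≤ 0 := by simpa using hw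
      simp only [comp_apply, ofComplex_apply_of_im_nonpos hw, ofComplex_apply_of_im_nonpos hw']
  refine ⟨hmem, ?_⟩
  ext n
  exact (qExpansion_coeff_unique (⟨f, hf.continuous⟩ : C(ℍ, ℂ)) one_pos
    (analyticAt_cuspFunction hmem) h n).symm

/-- With f = F ∘ q, the chain rule turns the normalized derivative into q F'(q), and F' is expanded
in its Taylor series on the unit disc. -/
lemma hasSum_normalizedDerivOfComplex {f : ℍ → ℂ} (hf : f ∈ cuspHolomorphic) (z : ℍ) :
    HasSum (fun n => (theta ℂ (qExpansion 1 f)).coeff n • Periodic.qParam 1 z ^ n)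
      (normalizedDerivOfComplex f z) := by
  set F := cuspFunction 1 f with hF
  set q := Periodic.qParam 1 z with hq
  have hqn : ‖q‖ < 1 := Periodic.norm_qParam_lt_one one_pos z.im_pos
  have hFd : DifferentiableOn ℂ F (Metric.ball 0 1) :=
    differentiableOn_cuspFunction_ball one_pos hf.1 hf.2.1 hf.2.2
  have hsum := Complex.hasSum_taylorSeries_on_ball (hFd.deriv Metric.isOpen_ball)
    (show q ∈ Metric.ball (0 : ℂ) 1 by simpa using hqn)
  have hderiv : normalizedDerivOfComplex f z = q * deriv F q := by
    have hev : f ∘ ofComplex =ᶠ[𝓝 (z : ℂ)] F ∘ Periodic.qParam 1 := by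
      filter_upwards [isOpen_upperHalfPlaneSet.mem_nhds z.im_pos] with w hw
      have := eq_cuspFunction ⟨w, hw⟩ one_ne_zero hf.1
      simp only [comp_apply, ofComplex_apply_of_im_pos hw]
      exact this.symm
    have hFq : HasDerivAt F (deriv F q) q :=
      (hFd.differentiableAt (Metric.isOpen_ball.mem_nhds (by simpa using hqn))).hasDerivAt
    have hqd : HasDerivAt (Periodic.qParam 1) (q * (2 * π * Complex.I)) (z : ℂ) := by
      have : HasDerivAt (fun w : ℂ => 2 * π * Complex.I * w / ((1 : ℝ) : ℂ))
          (2 * π * Complex.I) (z : ℂ) := by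
        simpa using (hasDerivAt_id (z : ℂ)).const_mul (2 * π * Complex.I)
      exact this.cexp
    rw [normalizedDerivOfComplex, hev.deriv_eq, (hFq.comp (z : ℂ) hqd).deriv]
    have : (2 * π * Complex.I) ≠ 0 := Complex.two_pi_I_ne_zero
    field_simp
  rw [hderiv, ← hasSum_nat_add_iff' 1]
  convert! hsum.mul_left q using 1
  · ext n
    rw [coeff_theta, qExpansion_coeff, ← iteratedDeriv_succ', ← hF, Nat.factorial_succ]
    have : ((n + 1 : ℕ) : ℂ) ≠ 0 := Nat.cast_ne_zero.mpr n.succ_ne_zero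
    have : (n.factorial : ℂ) ≠ 0 := Nat.cast_ne_zero.mpr n.factorial_ne_zero
    simp only [smul_eq_mul, sub_zero, Nat.cast_mul]
    field_simp
    ring
  · simp [coeff_theta]

lemma normalizedDerivOfComplex_mem {f : ℍ → ℂ} (hf : f ∈ cuspHolomorphic) :
    normalizedDerivOfComplex f ∈ cuspHolomorphic ∧
      qExpansion 1 (normalizedDerivOfComplex f) = theta ℂ (qExpansion 1 f) :=
  mem_cuspHolomorphic_of_hasSum (normalizedDerivOfComplex_mdifferentiable hf.2.1)
    (hasSum_normalizedDerivOfComplex hf)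

/-- The `q`-series `1 + c ∑ σ_s(n) q ^ n`. -/
def eisensteinQSeries (c : ℤ) (s : ℕ) : ℤ⟦X⟧ :=
  PowerSeries.mk fun n => if n = 0 then 1 else c * (ArithmeticFunction.sigma s n : ℕ)

lemma E2_mem : E2 ∈ cuspHolomorphic ∧
    qExpansion 1 E2 = (eisensteinQSeries (-24) 1).map (Int.castRingHom ℂ) := by
  refine mem_cuspHolomorphic_of_hasSum E2_mdifferentiable fun z => ?_
  convert! hasSum_qExpansion_E2 (z := z) using 2 with n
  · simp only [eisensteinQSeries, coeff_map, coeff_mk]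
    split_ifs <;> simp [Periodic.qParam]

lemma qExpansion_E₄ :
    qExpansion 1 E₄ = (eisensteinQSeries 240 3).map (Int.castRingHom ℂ) := by
  ext n
  rw [E_qExpansion_coeff _ ⟨2, rfl⟩]
  simp only [eisensteinQSeries, coeff_map, coeff_mk]
  split_ifs
  · simp
  · norm_num [show bernoulli 4 = -1 / 30 by decide +kernel]

lemma qExpansion_E₆ :
    qExpansion 1 E₆ = (eisensteinQSeries (-504) 5).map (Int.castRingHom ℂ) := by
  ext n
  rw [E_qExpansion_coeff _ ⟨3, rfl⟩]
  simp only [eisensteinQSeries, coeff_map, coeff_mk]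
  split_ifs
  · simp
  · norm_num [show bernoulli 6 = 1 / 42 by decide +kernel]

/-- A slash invariant element of `cuspHolomorphic` is a modular form. -/
def modularFormOfSlashInvariant {w : ℤ} (f : ℍ → ℂ) (hf : f ∈ cuspHolomorphic)
    (h : ∀ γ : SL(2, ℤ), f ∣[w] γ = f) : ModularForm 𝒮ℒ w where
  toFun := f
  slash_action_eq' := fun _ ⟨γ, hγ⟩ => hγ ▸ h γ
  holo' := hf.2.1
  bdd_at_cusps' {c} hc := by
    rw [Subgroup.IsArithmetic.isCusp_iff_isCusp_SL2Z] at hc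
    rw [OnePoint.isBoundedAt_iff_forall_SL2Z hc]
    intro γ _
    rw [h γ]
    exact hf.2.2

lemma slash_eq_self {w : ℤ} (f : ModularForm 𝒮ℒ w) (γ : SL(2, ℤ)) : (f : ℍ → ℂ) ∣[w] γ = f :=
  SlashInvariantFormClass.slash_action_eq f _ ⟨γ, rfl⟩

lemma serreDerivative_mem {w : ℤ} (f : ModularForm 𝒮ℒ w) :
    serreDerivative w f ∈ cuspHolomorphic ∧ qExpansion 1 (serreDerivative w f) =
      theta ℂ (qExpansion 1 f) - PowerSeries.C ((w : ℂ) * 12⁻¹) *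
        (qExpansion 1 E2 * qExpansion 1 f) := by
  have hf := coe_mem_cuspHolomorphic f
  obtain ⟨hD, hDq⟩ := normalizedDerivOfComplex_mem hf
  have he : serreDerivative w f = normalizedDerivOfComplex f - ((w : ℂ) * 12⁻¹) • (E2 * f) := by
    ext z
    simp only [serreDerivative_apply, Pi.sub_apply, Pi.smul_apply, Pi.mul_apply, smul_eq_mul]
    ring
  have hE := mul_mem E2_mem.1 hf
  have hsm := Subalgebra.smul_mem _ hE ((w : ℂ) * 12⁻¹)
  rw [he]
  refine ⟨sub_mem hD hsm, ?_⟩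
  rw [qExpansion_sub (analyticAt_cuspFunction hD) (analyticAt_cuspFunction hsm),
    qExpansion_smul (analyticAt_cuspFunction hE),
    qExpansion_mul (analyticAt_cuspFunction E2_mem.1) (analyticAt_cuspFunction hf), hDq,
    smul_eq_C_mul]

/-- The Serre derivative of a modular form. -/
noncomputable def serreForm {w : ℤ} (f : ModularForm 𝒮ℒ w) : ModularForm 𝒮ℒ (w + 2) :=
  modularFormOfSlashInvariant (serreDerivative w f) (serreDerivative_mem f).1
    fun γ => serreDerivative_slash_invariant (ModularFormClass.holo f) (slash_eq_self f γ)

lemma constantCoeff_qExpansion_E {w : ℕ} (hw : 3 ≤ w) (hw2 : Even w) :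
    constantCoeff (qExpansion 1 (E hw)) = 1 := by
  rw [← coeff_zero_eq_constantCoeff_apply]
  exact E_qExpansion_coeff_zero hw hw2

/-- A modular form in a one-dimensional space is determined by its constant term. -/
lemma qExpansion_eq_of_rank_one {w : ℕ} (hw : 3 ≤ w) (hw2 : Even w)
    (hr : Module.rank ℂ (ModularForm 𝒮ℒ w) = 1) (f : ModularForm 𝒮ℒ w) :
    qExpansion 1 f = PowerSeries.C (constantCoeff (qExpansion 1 f)) * qExpansion 1 (E hw) := by
  obtain ⟨c, rfl⟩ := (finrank_eq_one_iff_of_nonzero' (E hw) (E_ne_zero hw hw2)).mp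
    (Module.rank_eq_one_iff_finrank_eq_one.mp hr) f
  have h1 : constantCoeff (qExpansion 1 (E hw)) = 1 := constantCoeff_qExpansion_E hw hw2
  rw [FunLike.coe_smul, ModularForm.qExpansion_smul one_pos one_mem_strictPeriods_SL,
    smul_eq_C_mul, map_mul, h1, constantCoeff_C, mul_one]

lemma D2_hasDerivAt (γ : SL(2, ℤ)) (z : ℍ) : HasDerivAt (D2 γ ∘ ofComplex)
    (-(2 * π * Complex.I) * (γ 1 0 / denom γ z) ^ 2) (z : ℂ) := by
  have h := (hasDerivAt_denom_zpow (γ : GL (Fin 2) ℝ) (-1) z).const_mul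
    (2 * π * Complex.I * (γ 1 0 : ℂ))
  have hne := denom_ne_zero (γ : GL (Fin 2) ℝ) z
  have hev : D2 γ ∘ ofComplex =ᶠ[𝓝 (z : ℂ)]
      fun w => 2 * π * Complex.I * (γ 1 0 : ℂ) * denom (γ : GL (Fin 2) ℝ) w ^ (-1 : ℤ) := by
    filter_upwards [isOpen_upperHalfPlaneSet.mem_nhds z.im_pos] with w hw
    simp [D2, ofComplex_apply_of_im_pos hw, div_eq_mul_inv]
  refine (h.congr_of_eventuallyEq hev).congr_deriv ?_
  rw [show (-1 - 1 : ℤ) = -2 by norm_num, zpow_neg]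
  simp
  field_simp

lemma D2_mdifferentiable (γ : SL(2, ℤ)) : MDiff (D2 γ) := fun z =>
  mdifferentiableAt_iff.mpr (D2_hasDerivAt γ z).differentiableAt

/-- Under γ the derivative of E₂ acquires terms in E₂·c/(cz + d) and in (c/(cz + d))²; both cancel
against those of E₂²/12, using ζ(2) = π²/6. -/
lemma E2_deriv_slash (γ : SL(2, ℤ)) :
    (normalizedDerivOfComplex E2 - (12⁻¹ : ℂ) • (E2 * E2)) ∣[(4 : ℤ)] γ =
      normalizedDerivOfComplex E2 - (12⁻¹ : ℂ) • (E2 * E2) := by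
  ext z
  have h1 := congrFun (normalizedDerivOfComplex_SL_slash (k := 2) E2_mdifferentiable (γ := γ)) z
  have h2 := E2_slash_action γ
  have hmul := congrFun (ModularForm.mul_slash_SL2 2 2 γ E2 E2) z
  have h3 : normalizedDerivOfComplex (E2 ∣[(2 : ℤ)] γ) z = normalizedDerivOfComplex E2 z +
      1 / (2 * riemannZeta 2) * (γ 1 0 / denom γ z) ^ 2 := by
    rw [h2, normalizedDerivOfComplex_sub _ _ E2_mdifferentiable
      ((D2_mdifferentiable γ).const_smul _), normalizedDerivOfComplex_smul _ _
      (D2_mdifferentiable γ)]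
    simp only [Pi.sub_apply, Pi.smul_apply, smul_eq_mul]
    rw [normalizedDerivOfComplex, normalizedDerivOfComplex, (D2_hasDerivAt γ z).deriv]
    have : (2 * π * Complex.I) ≠ 0 := Complex.two_pi_I_ne_zero
    field_simp
    ring
  have h4 := congrFun h2 z
  simp only [Pi.sub_apply, Pi.smul_apply, Pi.mul_apply, smul_eq_mul, D2] at h1 h4 hmul ⊢
  norm_num at h1 hmul
  have h5 : ((normalizedDerivOfComplex E2 - (12⁻¹ : ℂ) • (E2 * E2)) ∣[(4 : ℤ)] γ) z =
      (normalizedDerivOfComplex E2 ∣[(4 : ℤ)] γ) z - 12⁻¹ * ((E2 * E2) ∣[(4 : ℤ)] γ) z := by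
    rw [sub_eq_add_neg, SlashAction.add_slash, SlashAction.neg_slash, SL_smul_slash]
    simp [sub_eq_add_neg]
  rw [h5, hmul]
  have hpi : (π : ℂ) ≠ 0 := Complex.ofReal_ne_zero.mpr Real.pi_ne_zero
  rw [h3] at h1
  rw [h4] at h1 ⊢
  rw [riemannZeta_two] at h1 ⊢
  rw [mul_div_assoc] at h1 ⊢
  set x := (γ 1 0 : ℂ) / denom γ z
  have e1 : 1 / (2 * ((π : ℂ) ^ 2 / 6)) * (2 * π * Complex.I * x) =
      6 * (π : ℂ)⁻¹ * Complex.I * x := by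
    field_simp
  have e2 : 1 / (2 * ((π : ℂ) ^ 2 / 6)) = 3 * (π : ℂ)⁻¹ ^ 2 := by
    field_simp
    norm_num
  rw [e1] at h1 ⊢
  rw [e2] at h1
  linear_combination (-1 : ℂ) * h1 + 3 * (π : ℂ)⁻¹ ^ 2 * x ^ 2 * Complex.I_sq

end Analytic

/-! ### Ramanujan's differential equations from one-dimensional spaces of weights 4, 6 and 8. -/

section Ramanujan

open Function Derivative EisensteinSeries ModularForm
open scoped Manifold Real Topology

lemma constantCoeff_qExpansion_E2 : constantCoeff (qExpansion 1 E2) = 1 := by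
  rw [E2_mem.2, ← coeff_zero_eq_constantCoeff_apply]
  simp [eisensteinQSeries]

lemma theta_qExpansion_E₄ : 3 * theta ℂ (qExpansion 1 E₄) =
    qExpansion 1 E2 * qExpansion 1 E₄ - qExpansion 1 E₆ := by
  have h := qExpansion_eq_of_rank_one (w := 6) (by norm_num) ⟨3, rfl⟩ levelOne_weight_six_rank_one
    ((serreForm E₄).mcast (by norm_num))
  have h2 : qExpansion 1 ((serreForm E₄).mcast (show _ = ((6 : ℕ) : ℤ) by norm_num)) = _ :=
    (serreDerivative_mem E₄).2
  have h4 := constantCoeff_qExpansion_E (w := 4) (by norm_num) ⟨2, rfl⟩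
  have hc : ((4 : ℤ) : ℂ) * 12⁻¹ = 3⁻¹ := by norm_num
  have e1 : 3 * PowerSeries.C (3⁻¹ : ℂ) = 1 := by
    rw [← map_ofNat (PowerSeries.C (R := ℂ)) 3, ← map_mul]
    norm_num
  rw [h2, hc] at h
  simp only [map_sub, map_mul, constantCoeff_theta, constantCoeff_C, h4,
    constantCoeff_qExpansion_E2, mul_one, zero_sub, map_neg] at h
  linear_combination 3 * h + (qExpansion 1 E2 * qExpansion 1 E₄ - qExpansion 1 E₆) * e1

lemma qExpansion_E₈ : qExpansion 1 (E (show 3 ≤ 8 by norm_num)) = qExpansion 1 E₄ ^ 2 := by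
  have hr : Module.rank ℂ (ModularForm 𝒮ℒ ((8 : ℕ) : ℤ)) = 1 := by
    rw [dimension_level_one 8 ⟨4, rfl⟩]
    simp [Nat.ModEq]
  have h := qExpansion_eq_of_rank_one (w := 8) (by norm_num) ⟨4, rfl⟩ hr
    ((E₄.mul E₄).mcast (by norm_num))
  have h2 : qExpansion 1 ((E₄.mul E₄).mcast (show _ = ((8 : ℕ) : ℤ) by norm_num)) = _ :=
    ModularForm.qExpansion_mul one_pos one_mem_strictPeriods_SL E₄ E₄
  have h4 := constantCoeff_qExpansion_E (w := 4) (by norm_num) ⟨2, rfl⟩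
  rw [h2, map_mul, h4, mul_one, map_one, one_mul] at h
  rw [← h, pow_two]

lemma theta_qExpansion_E₆ : 2 * theta ℂ (qExpansion 1 E₆) =
    qExpansion 1 E2 * qExpansion 1 E₆ - qExpansion 1 E₄ ^ 2 := by
  have hr : Module.rank ℂ (ModularForm 𝒮ℒ ((8 : ℕ) : ℤ)) = 1 := by
    rw [dimension_level_one 8 ⟨4, rfl⟩]
    simp [Nat.ModEq]
  have h := qExpansion_eq_of_rank_one (w := 8) (by norm_num) ⟨4, rfl⟩ hr
    ((serreForm E₆).mcast (by norm_num))
  have h2 : qExpansion 1 ((serreForm E₆).mcast (show _ = ((8 : ℕ) : ℤ) by norm_num)) = _ :=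
    (serreDerivative_mem E₆).2
  have h6 := constantCoeff_qExpansion_E (w := 6) (by norm_num) ⟨3, rfl⟩
  have hc : ((6 : ℤ) : ℂ) * 12⁻¹ = 2⁻¹ := by norm_num
  have e1 : 2 * PowerSeries.C (2⁻¹ : ℂ) = 1 := by
    rw [← map_ofNat (PowerSeries.C (R := ℂ)) 2, ← map_mul]
    norm_num
  rw [h2, hc, qExpansion_E₈] at h
  simp only [map_sub, map_mul, constantCoeff_theta, constantCoeff_C, h6,
    constantCoeff_qExpansion_E2, mul_one, zero_sub, map_neg] at h
  linear_combination 2 * h + (qExpansion 1 E2 * qExpansion 1 E₆ - qExpansion 1 E₄ ^ 2) * e1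

lemma theta_qExpansion_E2 : 12 * theta ℂ (qExpansion 1 E2) =
    qExpansion 1 E2 ^ 2 - qExpansion 1 E₄ := by
  obtain ⟨hD, hDq⟩ := normalizedDerivOfComplex_mem E2_mem.1
  have hE := mul_mem E2_mem.1 E2_mem.1
  have hsm := Subalgebra.smul_mem _ hE (12⁻¹ : ℂ)
  have h := qExpansion_eq_of_rank_one (w := 4) (by norm_num) ⟨2, rfl⟩ levelOne_weight_four_rank_one
    (modularFormOfSlashInvariant _ (sub_mem hD hsm) E2_deriv_slash)
  have h2 : qExpansion 1 (modularFormOfSlashInvariant _ (sub_mem hD hsm) E2_deriv_slash) =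
      theta ℂ (qExpansion 1 E2) - PowerSeries.C (12⁻¹ : ℂ) *
        (qExpansion 1 E2 * qExpansion 1 E2) := by
    change qExpansion 1 (normalizedDerivOfComplex E2 - (12⁻¹ : ℂ) • (E2 * E2)) = _
    rw [qExpansion_sub (analyticAt_cuspFunction hD) (analyticAt_cuspFunction hsm),
      qExpansion_smul (analyticAt_cuspFunction hE), hDq, smul_eq_C_mul,
      qExpansion_mul (analyticAt_cuspFunction E2_mem.1) (analyticAt_cuspFunction E2_mem.1)]
  have e1 : 12 * PowerSeries.C (12⁻¹ : ℂ) = 1 := by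
    rw [← map_ofNat (PowerSeries.C (R := ℂ)) 12, ← map_mul]
    norm_num
  rw [h2] at h
  simp only [map_sub, map_mul, constantCoeff_theta, constantCoeff_C,
    constantCoeff_qExpansion_E2, mul_one, zero_sub, map_neg] at h
  linear_combination 12 * h + (qExpansion 1 E2 ^ 2 - qExpansion 1 E₄) * e1

/-- The `q`-expansions of the Eisenstein series satisfy Ramanujan's differential equations. -/
lemma isRamanujanTriple_eisensteinQSeries : IsRamanujanTriple (eisensteinQSeries (-24) 1)
    (eisensteinQSeries 240 3) (eisensteinQSeries (-504) 5) := by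
  have hinj : Injective (PowerSeries.map (Int.castRingHom ℂ)) :=
    PowerSeries.map_injective _ (RingHom.injective_int _)
  have hP := E2_mem.2
  have hQ := qExpansion_E₄
  have hR := qExpansion_E₆
  refine ⟨?_, ?_, ?_, ?_, ?_, hinj ?_, hinj ?_, hinj ?_⟩
  · rw [← coeff_zero_eq_constantCoeff_apply]
    simp [eisensteinQSeries]
  · rw [← coeff_zero_eq_constantCoeff_apply]
    simp [eisensteinQSeries]
  · rw [← coeff_zero_eq_constantCoeff_apply]
    simp [eisensteinQSeries]
  · simp [eisensteinQSeries]
  · simp [eisensteinQSeries]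
  · rw [map_mul, map_theta, map_sub, map_pow, ← hP, ← hQ, ← theta_qExpansion_E2, map_ofNat]
  · rw [map_mul, map_theta, map_sub, map_mul, ← hP, ← hQ, ← hR, ← theta_qExpansion_E₄, map_ofNat]
  · rw [map_mul, map_theta, map_sub, map_mul, map_pow, ← hP, ← hQ, ← hR, ← theta_qExpansion_E₆,
      map_ofNat]

end Ramanujan

/-! ### Generation by E₄ and E₆, and spanning families in depth one. -/

section Structure

open Function EisensteinSeries ModularForm

/-- The monomial `E₄ ^ a * E₆ ^ b` is a modular form of weight `4 a + 6 b`. -/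
lemma exists_monomialForm (a b : ℕ) {w : ℤ} (h : (4 * a + 6 * b : ℤ) = w) :
    ∃ g : ModularForm 𝒮ℒ w, (g : ℍ → ℂ) = (E₄ : ℍ → ℂ) ^ a * (E₆ : ℍ → ℂ) ^ b := by
  refine ⟨((E₄.pow a).mul (E₆.pow b)).mcast (by rw [← h]; ring), ?_⟩
  change (⇑(E₄.pow a) * ⇑(E₆.pow b) : ℍ → ℂ) = _
  rw [ModularForm.coe_pow, ModularForm.coe_pow]

/-- The functions `E₄ ^ a * E₆ ^ b` of weight `w`. -/
def monomialFunctions (w : ℤ) : Set (ℍ → ℂ) :=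
  {f | ∃ a b : ℕ, (4 * a + 6 * b : ℤ) = w ∧ f = (E₄ : ℍ → ℂ) ^ a * (E₆ : ℍ → ℂ) ^ b}

lemma mul_mem_span {f g : ℍ → ℂ} {S T : Set (ℍ → ℂ)} (hg : g ∈ Submodule.span ℂ S)
    (h : ∀ s ∈ S, f * s ∈ Submodule.span ℂ T) : f * g ∈ Submodule.span ℂ T := by
  induction hg using Submodule.span_induction with
  | mem s hs => exact h s hs
  | zero => simp
  | add x y _ _ hx hy => simpa [mul_add] using add_mem hx hy
  | smul c x _ hx => simpa using Submodule.smul_mem _ c hx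

lemma discriminant_mul_mem_span {w : ℤ} {g : ℍ → ℂ}
    (hg : g ∈ Submodule.span ℂ (monomialFunctions (w - 12))) :
    discriminant * g ∈ Submodule.span ℂ (monomialFunctions w) := by
  refine mul_mem_span hg ?_
  rintro _ ⟨a, b, hab, rfl⟩
  have : (discriminant * ((E₄ : ℍ → ℂ) ^ a * (E₆ : ℍ → ℂ) ^ b) : ℍ → ℂ) =
      (1728⁻¹ : ℂ) • ((E₄ : ℍ → ℂ) ^ (a + 3) * (E₆ : ℍ → ℂ) ^ b) -
        (1728⁻¹ : ℂ) • ((E₄ : ℍ → ℂ) ^ a * (E₆ : ℍ → ℂ) ^ (b + 2)) := by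
    ext z
    simp only [Pi.mul_apply, Pi.sub_apply, Pi.smul_apply, Pi.pow_apply, smul_eq_mul,
      discriminant_eq_E₄_cube_sub_E₆_sq]
    ring
  rw [this]
  refine sub_mem (Submodule.smul_mem _ _ (Submodule.subset_span ⟨_, _, ?_, rfl⟩))
    (Submodule.smul_mem _ _ (Submodule.subset_span ⟨_, _, ?_, rfl⟩)) <;>
  · push_cast
    linarith

/-- Every modular form for `SL₂(ℤ)` is a polynomial in `E₄` and `E₆`. -/
lemma modularForm_mem_span {w : ℤ} (f : ModularForm 𝒮ℒ w) :
    (f : ℍ → ℂ) ∈ Submodule.span ℂ (monomialFunctions w) := by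
  rcases lt_or_ge w 0 with hw | hw
  · rw [ModularFormClass.levelOne_neg_weight_eq_zero hw f]
    exact zero_mem _
  lift w to ℕ using hw
  induction w using Nat.strong_induction_on with
  | _ w ih =>
    -- A form with zero constant term is Δ times a form of weight w - 12, covered by induction or
    -- zero for negative weight.
    have cusp : ∀ F : ModularForm 𝒮ℒ (w : ℤ), (qExpansion 1 F).coeff 0 = 0 →
        (F : ℍ → ℂ) ∈ Submodule.span ℂ (monomialFunctions w) := by
      intro F hF
      set G := CuspForm.discriminantEquiv (toCuspForm F hF) with hG
      have hFG : (F : ℍ → ℂ) = discriminant * (G : ℍ → ℂ) :=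
        (discriminant_mul_discriminantEquiv (toCuspForm F hF)).symm
      rw [hFG]
      refine discriminant_mul_mem_span ?_
      rcases lt_or_ge ((w : ℤ) - 12) 0 with hw | hw
      · rw [ModularFormClass.levelOne_neg_weight_eq_zero hw G]
        exact zero_mem _
      · have hcast : (w : ℤ) - 12 = ((w - 12 : ℕ) : ℤ) := by omega
        have := ih (w - 12) (by omega) (G.mcast hcast)
        rw [show monomialFunctions ((w : ℤ) - 12) = _ from congrArg monomialFunctions hcast]
        exact this
    by_cases hm : ∃ a b : ℕ, 4 * a + 6 * b = w
    · obtain ⟨a, b, hab⟩ := hm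
      obtain ⟨g, hg⟩ := exists_monomialForm a b (w := w) (by exact_mod_cast hab)
      set c := (qExpansion 1 f).coeff 0
      have hg0 : (qExpansion 1 g).coeff 0 = 1 := by
        have h4 := constantCoeff_qExpansion_E (w := 4) (by norm_num) ⟨2, rfl⟩
        have h6 := constantCoeff_qExpansion_E (w := 6) (by norm_num) ⟨3, rfl⟩
        rw [hg, ← ModularForm.coe_pow, ← ModularForm.coe_pow, ModularForm.qExpansion_mul_coe one_pos
          one_mem_strictPeriods_SL, ModularForm.qExpansion_pow one_pos one_mem_strictPeriods_SL,
          ModularForm.qExpansion_pow one_pos one_mem_strictPeriods_SL,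
          coeff_zero_eq_constantCoeff_apply, map_mul, map_pow, map_pow, h4, h6]
        simp
      have h := cusp (f - c • g) (by
        rw [FunLike.coe_sub, ModularForm.qExpansion_sub one_pos one_mem_strictPeriods_SL,
          FunLike.coe_smul, ModularForm.qExpansion_smul one_pos one_mem_strictPeriods_SL,
          map_sub, coeff_smul, hg0, smul_eq_mul, mul_one, sub_self])
      have hfg : (f : ℍ → ℂ) = ⇑(f - c • g) + c • (g : ℍ → ℂ) := by
        rw [FunLike.coe_sub, FunLike.coe_smul, sub_add_cancel]
      rw [hfg]
      refine add_mem h (Submodule.smul_mem _ _ (Submodule.subset_span ⟨a, b, ?_, hg⟩))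
      exact_mod_cast hab
    -- The nonnegative weights not of the form 4a + 6b are 2 and the odd ones, which carry no
    -- nonzero forms.
    · have hf : f = 0 := by
        rcases Nat.even_or_odd w with he | ho
        · have h2 : w = 2 := by
            by_contra h2
            obtain ⟨m, rfl⟩ := he
            rcases Nat.even_or_odd' m with ⟨t, rfl | rfl⟩
            · exact hm ⟨t, 0, by ring⟩
            · exact hm ⟨t - 1, 1, by omega⟩
          subst h2
          exact rank_zero_iff_forall_zero.mp levelOne_weight_two_rank_zero f
        · exact levelOne_odd_weight_eq_zero (by exact_mod_cast ho) f
      rw [hf]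
      exact zero_mem _

lemma mem_quasimodularForms_one {w : ℕ} {f : ℍ → ℂ} : f ∈ quasimodularForms 1 w ↔
    ∃ (A : ModularForm 𝒮ℒ w) (B : ModularForm 𝒮ℒ (w - 2)), f = ⇑A + E2 * ⇑B := by
  constructor
  · rintro ⟨g, hg⟩
    refine ⟨(g 0).mcast (by simp), (g 1).mcast (by simp), ?_⟩
    ext z
    simpa [Finset.sum_range_succ] using! hg z
  · rintro ⟨A, B, rfl⟩
    refine ⟨fun j => match j with
      | 0 => A.mcast (by simp)
      | 1 => B.mcast (by simp)
      | _ => 0, fun z => ?_⟩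
    simp [Finset.sum_range_succ]

/-- A basis of the depth one quasimodular forms of weight `6 k` or `6 k + 4`. -/
noncomputable def depthOneFunction (k δ n : ℕ) : ℍ → ℂ :=
  (E₄ : ℍ → ℂ) ^ δ * depthOneBasis (E2 : ℍ → ℂ) (E₄ : ℍ → ℂ) (E₆ : ℍ → ℂ) k n

lemma depthOneFunction_mem (k δ n : ℕ) (hn : n ≤ k) :
    depthOneFunction k δ n ∈ quasimodularForms 1 (6 * k + 4 * δ) := by
  rw [mem_quasimodularForms_one]
  rcases Nat.even_or_odd' n with ⟨i, rfl | rfl⟩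
  · obtain ⟨g, hg⟩ := exists_monomialForm (δ + 3 * i) (k - 2 * i)
      (w := (6 * k + 4 * δ : ℕ)) (by push_cast [Nat.cast_sub hn]; ring)
    refine ⟨g, 0, ?_⟩
    rw [hg, depthOneFunction, depthOneBasis, FunLike.coe_zero]
    simp only [Nat.mul_mod_right, Nat.mul_div_cancel_left i two_pos]
    ring
  · obtain ⟨g, hg⟩ := exists_monomialForm (δ + 3 * i + 1) (k - (2 * i + 1))
      (w := (6 * k + 4 * δ : ℕ) - 2) (by push_cast [Nat.cast_sub hn]; ring)
    refine ⟨0, g, ?_⟩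
    rw [hg, depthOneFunction, depthOneBasis, FunLike.coe_zero]
    simp only [show (2 * i + 1) % 2 = 1 by omega, show (2 * i + 1) / 2 = i by omega]
    ring

/-- Reducing 4a + 6b = w modulo 3 fixes a modulo 3: a = δ + 3i in the modular part and a = δ + 3i +
1 in the coefficient of E₂. These are the indices n = 2i and n = 2i + 1. -/
lemma quasimodularForms_eq_span (k δ : ℕ) (hδ : δ ≤ 1) :
    quasimodularForms 1 (6 * k + 4 * δ) =
      Submodule.span ℂ (Set.range fun n : Fin (k + 1) => depthOneFunction k δ n) := by
  apply le_antisymm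
  · intro f hf
    obtain ⟨A, B, rfl⟩ := mem_quasimodularForms_one.mp hf
    refine add_mem ?_ (mul_mem_span (modularForm_mem_span B) ?_)
    · refine Submodule.span_le.mpr ?_ (modularForm_mem_span A)
      rintro _ ⟨a, b, hab, rfl⟩
      obtain ⟨i, rfl⟩ : ∃ i, a = δ + 3 * i := ⟨(a - δ) / 3, by omega⟩
      refine Submodule.subset_span ⟨⟨2 * i, by omega⟩, ?_⟩
      have hb : k - 2 * i = b := by omega
      simp only [depthOneFunction, depthOneBasis, Nat.mul_mod_right,
        Nat.mul_div_cancel_left i two_pos, hb]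
      ring
    · rintro _ ⟨a, b, hab, rfl⟩
      obtain ⟨i, rfl⟩ : ∃ i, a = δ + 3 * i + 1 := ⟨(a - δ - 1) / 3, by omega⟩
      refine Submodule.subset_span ⟨⟨2 * i + 1, by omega⟩, ?_⟩
      have hb : k - (2 * i + 1) = b := by omega
      simp only [depthOneFunction, depthOneBasis, show (2 * i + 1) % 2 = 1 by omega,
        show (2 * i + 1) / 2 = i by omega, hb]
      ring
  · rw [Submodule.span_le]
    rintro _ ⟨n, rfl⟩
    exact depthOneFunction_mem k δ n (by omega)

end Structure

/-! ### Existence, uniqueness, depth and denominators of the extremal forms. -/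

section Extremal

open Function EisensteinSeries ModularForm

local notation "P" => PowerSeries.map (Int.castRingHom ℂ) (eisensteinQSeries (-24) 1)
local notation "Q" => PowerSeries.map (Int.castRingHom ℂ) (eisensteinQSeries 240 3)
local notation "R" => PowerSeries.map (Int.castRingHom ℂ) (eisensteinQSeries (-504) 5)

lemma constantCoeff_Q : constantCoeff (Q) = 1 :=
  (isRamanujanTriple_eisensteinQSeries.map (Int.castRingHom ℂ)).Q_zero

lemma sum_depthOneFunction_mem (k δ : ℕ) (x : Fin (k + 1) → ℂ) :
    (∑ n, x n • depthOneFunction k δ n) ∈ cuspHolomorphic ∧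
      qExpansion 1 (∑ n, x n • depthOneFunction k δ n) =
        Q ^ δ * ∑ n, x n • depthOneBasis P Q R k n := by
  let p : cuspHolomorphic := ⟨E2, E2_mem.1⟩
  let q : cuspHolomorphic := ⟨E₄, coe_mem_cuspHolomorphic E₄⟩
  let r : cuspHolomorphic := ⟨E₆, coe_mem_cuspHolomorphic E₆⟩
  let F : cuspHolomorphic := ∑ n : Fin (k + 1), x n • (q ^ δ * depthOneBasis p q r k n)
  have hF : (F : ℍ → ℂ) = ∑ n, x n • depthOneFunction k δ n := by
    simp [F, depthOneFunction, depthOneBasis, p, q, r]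
  have hp : qExpansionHom p = P := E2_mem.2
  have hq : qExpansionHom q = Q := qExpansion_E₄
  have hr : qExpansionHom r = R := qExpansion_E₆
  rw [← hF]
  refine ⟨F.2, ?_⟩
  rw [← qExpansionHom_apply]
  simp only [F, map_sum, map_smul, map_mul, map_pow, depthOneBasis, hp, hq, hr, Finset.mul_sum,
    mul_smul_comm]

lemma linearIndependent_depthOneFunction (k δ : ℕ) :
    LinearIndependent ℂ fun n : Fin (k + 1) => depthOneFunction k δ n := by
  rw [Fintype.linearIndependent_iff]
  intro x hx
  have h := (sum_depthOneFunction_mem k δ x).2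
  rw [hx, qExpansion_zero, eq_comm, mul_eq_zero] at h
  have hQ : (Q) ≠ 0 := by
    intro hQ
    simpa [hQ] using constantCoeff_Q
  have hz := h.resolve_left (pow_ne_zero _ hQ)
  refine congrFun (Matrix.eq_zero_of_vecMul_eq_zero
    (coeffMatrix_complex_det_ne_zero isRamanujanTriple_eisensteinQSeries k) (funext fun j => ?_))
  rw [vecMul_coeffMatrix, hz]
  simp

lemma finrank_quasimodularForms (k δ : ℕ) (hδ : δ ≤ 1) :
    Module.finrank ℂ (quasimodularForms 1 (6 * k + 4 * δ)) = k + 1 := by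
  rw [quasimodularForms_eq_span k δ hδ,
    finrank_span_eq_card (linearIndependent_depthOneFunction k δ), Fintype.card_fin]

lemma coeff_eq_single_iff {K : Type*} [CommRing K] {k : ℕ} {φ : K⟦X⟧} :
    ((∀ n, n + 1 < k + 1 → φ.coeff n = 0) ∧ φ.coeff k = 1) ↔ X ^ (k + 1) ∣ φ - X ^ k := by
  rw [X_pow_dvd_iff]
  constructor
  · rintro ⟨h1, h2⟩ n hn
    rw [map_sub, coeff_X_pow]
    split_ifs with h
    · rw [h, h2, sub_self]
    · rw [h1 n (by omega), sub_zero]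
  · intro h
    refine ⟨fun n hn => ?_, ?_⟩
    · have := h n (by omega)
      rwa [map_sub, coeff_X_pow, if_neg (by omega), sub_zero] at this
    · have := h k (by omega)
      rwa [map_sub, coeff_X_pow_self, sub_eq_zero] at this

/-- Applied with u = Q^δ, this is why one coordinate vector serves both weights. -/
lemma X_pow_dvd_mul_sub_iff {K : Type*} [CommRing K] {k : ℕ} {u φ : K⟦X⟧}
    (hu : constantCoeff u = 1) : X ^ (k + 1) ∣ u * φ - X ^ k ↔ X ^ (k + 1) ∣ φ - X ^ k := by
  have h1 : X ^ (k + 1) ∣ X ^ k * (u - 1) := by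
    rw [pow_succ]
    exact mul_dvd_mul_left _ (X_dvd_iff.mpr (by simp [hu]))
  have h2 : u * φ - X ^ k = u * (φ - X ^ k) + X ^ k * (u - 1) := by ring
  have hunit : IsUnit u := by simp [isUnit_iff_constantCoeff, hu]
  rw [h2, dvd_add_left h1]
  exact hunit.dvd_mul_left

lemma hasNormalizedExtremalExpansion_iff {k δ : ℕ} (hδ : δ ≤ 1) {x : Fin (k + 1) → ℂ}
    (hx : Matrix.vecMul x (coeffMatrix P Q R k) = Pi.single (Fin.last k) 1) {h : ℍ → ℂ} :
    HasNormalizedExtremalExpansion 1 (6 * k + 4 * δ) h ↔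
      h = ∑ n, x n • depthOneFunction k δ n := by
  have hQ : constantCoeff (Q ^ δ) = 1 := by rw [map_pow, constantCoeff_Q, one_pow]
  have key : ∀ y : Fin (k + 1) → ℂ,
      X ^ (k + 1) ∣ qExpansion 1 (∑ n, y n • depthOneFunction k δ n) - X ^ k ↔ y = x := by
    intro y
    rw [(sum_depthOneFunction_mem k δ y).2, X_pow_dvd_mul_sub_iff hQ]
    have hdet := coeffMatrix_complex_det_ne_zero isRamanujanTriple_eisensteinQSeries k
    have hiff : X ^ (k + 1) ∣ (∑ n, y n • depthOneBasis P Q R k n) - X ^ k ↔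
        Matrix.vecMul y (coeffMatrix P Q R k) = Pi.single (Fin.last k) 1 := by
      rw [X_pow_dvd_iff]
      constructor
      · intro hy
        ext j
        have := hy j j.isLt
        rw [map_sub, sub_eq_zero] at this
        rw [vecMul_coeffMatrix, this, coeff_X_pow, Pi.single_apply]
        simp [Fin.ext_iff]
      · intro hy n hn
        have := congrFun hy ⟨n, hn⟩
        rw [vecMul_coeffMatrix] at this
        rw [map_sub, this, coeff_X_pow, Pi.single_apply]
        simp [Fin.ext_iff]
    rw [hiff, ← hx]
    exact (Matrix.vecMul_injective_of_isUnit
      ((Matrix.isUnit_iff_isUnit_det _).mpr (isUnit_iff_ne_zero.mpr hdet))).eq_iff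
  have hrank := finrank_quasimodularForms k δ hδ
  constructor
  · rintro ⟨hmem, h0, h1⟩
    rw [hrank] at h0 h1
    rw [quasimodularForms_eq_span k δ hδ] at hmem
    obtain ⟨y, rfl⟩ := (Submodule.mem_span_range_iff_exists_fun ℂ).mp hmem
    rw [(key y).mp (coeff_eq_single_iff.mp ⟨h0, h1⟩)]
  · rintro rfl
    obtain ⟨h0, h1⟩ := coeff_eq_single_iff.mpr ((key x).mpr rfl)
    refine ⟨?_, by rwa [hrank], by rwa [hrank]⟩
    rw [quasimodularForms_eq_span k δ hδ]
    exact (Submodule.mem_span_range_iff_exists_fun ℂ).mpr ⟨x, rfl⟩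

lemma isNormalizedExtremal_of_expansion {k δ : ℕ} (hδ : δ ≤ 1) (hk : 1 ≤ k) {f : ℍ → ℂ}
    (h : HasNormalizedExtremalExpansion 1 (6 * k + 4 * δ) f) :
    IsNormalizedExtremal 1 (6 * k + 4 * δ) f := by
  refine ⟨h, ?_⟩
  rintro l hl ⟨g, hg⟩
  obtain rfl : l = 0 := by omega
  have h0 := h.coeff_eq_zero
  have h1 := h.coeff_eq_one
  rw [finrank_quasimodularForms k δ hδ] at h0 h1
  have hfg : f = g 0 := by
    ext z
    simpa using hg z
  rw [hfg] at h0 h1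
  have hz : g 0 = 0 := by
    -- In depth 0 the form is modular of weight at most 6k + 4 < 12k, as k ≥ 1, yet vanishes to
    -- order k, so it is zero and its coefficient at q^k cannot be 1.
    refine sturm_bound_levelOne (lt_of_lt_of_le ?_
      (PowerSeries.nat_le_order _ k fun n hn => h0 n (by omega)))
    exact_mod_cast (by omega : ((((6 * k + 4 * δ : ℕ) : ℤ) - 2 * ((0 : ℕ) : ℤ)).toNat / 12) < k)
  rw [hz, FunLike.coe_zero, qExpansion_zero] at h1
  simp at h1

lemma coeff_sum_depthOneFunction_mem {k N : ℕ} (δ : ℕ) {x : Fin (k + 1) → ℂ}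
    (hx : ∀ n, x n ∈ primeInvRing N) (m : ℕ) :
    (qExpansion 1 (∑ n, x n • depthOneFunction k δ n)).coeff m ∈ primeInvRing N := by
  rw [(sum_depthOneFunction_mem k δ x).2, Finset.mul_sum, map_sum]
  refine sum_mem fun n _ => ?_
  rw [mul_smul_comm, coeff_smul, smul_eq_mul]
  refine mul_mem (hx n) ?_
  have : Q ^ δ * depthOneBasis P Q R k n = PowerSeries.map (Int.castRingHom ℂ)
      ((eisensteinQSeries 240 3) ^ δ * depthOneBasis (eisensteinQSeries (-24) 1)
        (eisensteinQSeries 240 3) (eisensteinQSeries (-504) 5) k n) := by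
    simp only [depthOneBasis, map_mul, map_pow]
  rw [this, coeff_map]
  exact intCast_mem _ _

end Extremal

end Quasimodular

theorem mainTheorem2 (k : ℕ) :
    Module.finrank ℂ (Quasimodular.quasimodularForms 1 (6 * k)) = k + 1 ∧
    Module.finrank ℂ (Quasimodular.quasimodularForms 1 (6 * k + 4)) = k + 1 ∧
    ∃ f g : ℍ → ℂ,
      (∀ h : ℍ → ℂ, Quasimodular.HasNormalizedExtremalExpansion 1 (6 * k + 4) h ↔ h = f) ∧
      (∀ h : ℍ → ℂ, Quasimodular.HasNormalizedExtremalExpansion 1 (6 * k) h ↔ h = g) ∧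
      (1 ≤ k → Quasimodular.IsNormalizedExtremal 1 (6 * k + 4) f ∧
        Quasimodular.IsNormalizedExtremal 1 (6 * k) g) ∧
      (∀ z : ℍ, f z = ModularForm.E₄ z * g z) ∧
      ∀ n : ℕ, (qExpansion 1 f).coeff n ∈ Quasimodular.primeInvRing (6 * k) := by
  obtain ⟨x, hxm, hx⟩ :=
    Quasimodular.exists_extremal_vector Quasimodular.isRamanujanTriple_eisensteinQSeries k
  have iff₀ := fun h => Quasimodular.hasNormalizedExtremalExpansion_iff (h := h) (Nat.zero_le 1) hx
  have iff₁ := fun h => Quasimodular.hasNormalizedExtremalExpansion_iff (h := h) (le_refl 1) hx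
  refine ⟨Quasimodular.finrank_quasimodularForms k 0 (Nat.zero_le 1),
    Quasimodular.finrank_quasimodularForms k 1 le_rfl,
    ∑ n, x n • Quasimodular.depthOneFunction k 1 n, ∑ n, x n • Quasimodular.depthOneFunction k 0 n,
    iff₁, iff₀, fun hk => ⟨?_, ?_⟩, fun z => ?_, Quasimodular.coeff_sum_depthOneFunction_mem 1 hxm⟩
  · exact Quasimodular.isNormalizedExtremal_of_expansion le_rfl hk ((iff₁ _).mpr rfl)
  · exact Quasimodular.isNormalizedExtremal_of_expansion (Nat.zero_le 1) hk ((iff₀ _).mpr rfl)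
  · simp only [Finset.sum_apply, Pi.smul_apply, smul_eq_mul, Finset.mul_sum,
      Quasimodular.depthOneFunction, Pi.mul_apply, pow_one, pow_zero, Pi.one_apply]
    exact Finset.sum_congr rfl fun n _ => by ring
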